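/- Let $R$ be a real closed field with a fixed o-minimal expansion (no saturation is needed); "definable" means definable with parameters in this expansion, and $R^n$ carries the product of the order topology of $R$. A \emph{locally definable space} is a set $M$ with a family $(M_i,\phi_i)_{i\in I}$ such that $M=\bigcup_{i\in I}M_i$, each $\phi_i\colon M_i\to Z_i$ is a bijection onto a definable set $Z_i\subseteq R^{n(i)}$, and for all $i,j\in I$ the set $\phi_i(M_i\cap M_j)$ is definable and relatively open in $Z_i$ and the transition map $\phi_j\circ\phi_i^{-1}\colon\phi_i(M_i\cap M_j)\to\phi_j(M_i\cap M_j)$ is definable and continuous. A set $O\subseteq M$ is open if $\phi_i(O\cap M_i)$ is relatively open in $Z_i$ for every $i\in I$. An \emph{ld-space} is a Hausdorff locally definable space. A subset $X\subseteq M$ is a \emph{definable subspace} if there is a finite $J\subseteq I$ with $X\subseteq\bigcup_{j\in J}M_j$ and $\phi_j(X\cap M_j)$ definable for all $j\in J$. The product $M\times N$ of two such spaces has the charts $\phi_i\times\psi_j$. A map between definable subspaces of $M$ and $N$ is \emph{definable} if its graph is a definable subspace of $M\times N$. A map $\theta\colon M\to N$ is an \emph{ld-map} if, for every $i\in I$,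 $\theta(M_i)$ is a definable subspace of $N$ and $\theta|_{M_i}\colon M_i\to\theta(M_i)$ is definable. An \emph{ld-path} in $M$ is a continuous ld-map $[0,1]\to M$, where $[0,1]\subseteq R$; the connected component in $Y\subseteq M$ of a point $x\in Y$ is the set of points that are joined to $x$ by an ld-path in $M$ with image in $Y$. A surjective continuous ld-map $\theta\colon M\to N$ between ld-spaces $(M,(M_i,\phi_i)_{i\in I})$ and $(N,(N_j,\psi_j)_{j\in J})$ is an \emph{ld-covering map} if there is a family $\{O_l:l\in\Lambda\}$ of open definable subspaces of $N$ such that (i) $N=\bigcup_{l\in\Lambda}O_l$; (ii) for every $j\in J$, the set $N_j$ is covered by finitely many of the $O_l$; and (iii) for every $l\in\Lambda$ and every connected component $D$ of $\theta^{-1}(O_l)$, $D$ is a definable subspace of $M$ and $\theta|_D\colon D\to O_l$ is a definable homeomorphism. \textbf{Proposition.} Let $M$ and $N$ be ld-spaces, let $\theta\colon M\to N$ be an ld-covering map, and let $C\subseteq M$ be a definable subspace that is closed in $M$. Then $\theta(C)$ is a definable subspace of $N$ and is closed in $N$. -/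

import Mathlib

open Set Topology

universe u v

/-- The points `{a}` and the open intervals of a linear order, with endpoints in the order or
at infinity. -/
inductive IsPointOrInterval {R : Type*} [LinearOrder R] : Set R → Prop
  | point (a : R) : IsPointOrInterval {a}
  | Ioo (a b : R) : IsPointOrInterval (Set.Ioo a b)
  | Iio (b : R) : IsPointOrInterval (Set.Iio b)
  | Ioi (a : R) : IsPointOrInterval (Set.Ioi a)
  | univ : IsPointOrInterval Set.univ

/-- "Definable" always means definable with parameters from the whole structure. -/
abbrev Dfn (L : FirstOrder.Language.{u, v}) {R : Type*} [L.Structure R] {α : Type*}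
    (s : Set (α → R)) : Prop :=
  (Set.univ : Set R).Definable L s

/-- The `L`-structure on `R` is an o-minimal expansion of the ordered field `R`: the order,
the addition and the multiplication of `R` are definable, and every definable subset of `R` is a
finite union of points and open intervals. -/
class OMinimalExpansion (L : FirstOrder.Language.{u, v}) (R : Type*) [Field R] [LinearOrder R]
    [L.Structure R] : Prop where
  definable_lt : Dfn L {v : Fin 2 → R | v 0 < v 1}
  definable_add : Dfn L {v : Fin 3 → R | v 0 + v 1 = v 2}
  definable_mul : Dfn L {v : Fin 3 → R | v 0 * v 1 = v 2}
  ominimal : ∀ s : Set R, (Set.univ : Set R).Definable₁ L s →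
    ∃ F : Set (Set R), F.Finite ∧ (∀ I ∈ F, IsPointOrInterval I) ∧ s = ⋃₀ F

/-- A locally definable space structure on the set `M`, with charts `chart i : dom i → target i`
indexed by `ι`. The map `chart i` is a total function for convenience; only its values on `dom i`
are ever used. The transition map `chart i x ↦ chart j x` (for `x ∈ dom i ∩ dom j`) is
definable and continuous. Definability of a map is definability of its graph. -/
structure LocDefSpace (L : FirstOrder.Language.{u, v}) (R : Type*) [L.Structure R] [TopologicalSpace R]
    (M : Type*) (ι : Type*) where
  dom : ι → Set M
  dim : ι → ℕ
  target : ∀ i, Set (Fin (dim i) → R)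
  chart : ∀ i, M → (Fin (dim i) → R)
  iUnion_dom : ⋃ i, dom i = Set.univ
  bijOn : ∀ i, Set.BijOn (chart i) (dom i) (target i)
  definable_target : ∀ i, Dfn L (target i)
  definable_overlap : ∀ i j, Dfn L (chart i '' (dom i ∩ dom j))
  relOpen_overlap : ∀ i j, ∃ U, IsOpen U ∧ chart i '' (dom i ∩ dom j) = target i ∩ U
  definable_transition : ∀ i j,
    Dfn L ((fun x => (Sum.elim (chart i x) (chart j x) : Fin (dim i) ⊕ Fin (dim j) → R)) ''
      (dom i ∩ dom j))
  continuous_transition : ∀ i j, ∃ g : (Fin (dim i) → R) → (Fin (dim j) → R),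
    ContinuousOn g (chart i '' (dom i ∩ dom j)) ∧ ∀ x ∈ dom i ∩ dom j, g (chart i x) = chart j x

namespace LocDefSpace

section Basic

variable {L : FirstOrder.Language.{u, v}} {R : Type*} [L.Structure R] [TopologicalSpace R]
  {M ι : Type*} (S : LocDefSpace L R M ι)

theorem chart_image_inter (i : ι) (s t : Set M) :
    S.chart i '' ((s ∩ t) ∩ S.dom i) =
      (S.chart i '' (s ∩ S.dom i)) ∩ (S.chart i '' (t ∩ S.dom i)) := by
  rw [← ((S.bijOn i).injOn.image_inter inter_subset_right inter_subset_right)]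
  congr 1
  ext x
  simp only [mem_inter_iff]
  tauto

/-- A set is open iff its trace on each chart domain corresponds to a relatively open subset of the
target of the chart. -/
def topology : TopologicalSpace M where
  IsOpen O := ∀ i, ∃ U, IsOpen U ∧ S.chart i '' (O ∩ S.dom i) = S.target i ∩ U
  isOpen_univ i := ⟨Set.univ, isOpen_univ, by
    rw [univ_inter, inter_univ, (S.bijOn i).image_eq]⟩
  isOpen_inter s t hs ht i := by
    obtain ⟨U, hU, hsU⟩ := hs i
    obtain ⟨V, hV, htV⟩ := ht i
    refine ⟨U ∩ V, hU.inter hV, ?_⟩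
    rw [chart_image_inter, hsU, htV, ← inter_inter_distrib_left]
  isOpen_sUnion s hs i := by
    choose! U hU hsU using fun t ht => hs t ht i
    refine ⟨⋃ t ∈ s, U t, isOpen_biUnion hU, ?_⟩
    rw [sUnion_eq_biUnion, iUnion₂_inter, image_iUnion₂, inter_iUnion₂]
    exact iUnion₂_congr hsU

/-- An ld-space is a Hausdorff locally definable space. -/
def IsLDSpace : Prop := @T2Space M S.topology

/-- `X` is contained in finitely many chart domains, in each of which it is definable. -/
def IsDefinableSubspace (X : Set M) : Prop :=
  ∃ J : Set ι, J.Finite ∧ X ⊆ ⋃ j ∈ J, S.dom j ∧ ∀ j ∈ J, Dfn L (S.chart j '' (X ∩ S.dom j))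

end Basic

section Prod

variable {L : FirstOrder.Language.{u, v}} {R : Type*} [L.Structure R] [TopologicalSpace R]
  {M ι N κ : Type*}

theorem append_image_prod {a b : ℕ} (f : M → Fin a → R) (g : N → Fin b → R)
    (s : Set M) (t : Set N) :
    (fun x : M × N => Fin.append (f x.1) (g x.2)) '' (s ×ˢ t) =
      ((fun v : Fin (a + b) → R => v ∘ Fin.castAdd b) ⁻¹' (f '' s)) ∩
      ((fun v : Fin (a + b) → R => v ∘ Fin.natAdd a) ⁻¹' (g '' t)) := by
  ext v
  constructor
  · rintro ⟨⟨x, y⟩, ⟨hx, hy⟩, rfl⟩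
    refine ⟨⟨x, hx, ?_⟩, ⟨y, hy, ?_⟩⟩ <;> ext k <;> simp
  · rintro ⟨⟨x, hx, hxv⟩, ⟨y, hy, hyv⟩⟩
    refine ⟨(x, y), ⟨hx, hy⟩, ?_⟩
    simp only [hxv, hyv]
    exact Fin.append_castAdd_natAdd

theorem dfn_append_image_prod {a b : ℕ} {f : M → Fin a → R} {g : N → Fin b → R}
    {s : Set M} {t : Set N} (hs : Dfn L (f '' s)) (ht : Dfn L (g '' t)) :
    Dfn L ((fun x : M × N => Fin.append (f x.1) (g x.2)) '' (s ×ˢ t)) := by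
  rw [append_image_prod]
  exact (hs.preimage_comp _).inter (ht.preimage_comp _)

/-- The product of two locally definable spaces, with charts
`chart i × chart j : dom i × dom j → target i × target j`. -/
def prod (S : LocDefSpace L R M ι) (T : LocDefSpace L R N κ) :
    LocDefSpace L R (M × N) (ι × κ) where
  dom p := S.dom p.1 ×ˢ T.dom p.2
  dim p := S.dim p.1 + T.dim p.2
  target p := (fun x : M × N => Fin.append (S.chart p.1 x.1) (T.chart p.2 x.2)) ''
    (S.dom p.1 ×ˢ T.dom p.2)
  chart p x := Fin.append (S.chart p.1 x.1) (T.chart p.2 x.2)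
  iUnion_dom := by
    ext ⟨x, y⟩
    have hx : x ∈ ⋃ i, S.dom i := S.iUnion_dom ▸ mem_univ x
    have hy : y ∈ ⋃ i, T.dom i := T.iUnion_dom ▸ mem_univ y
    simp only [mem_iUnion] at hx hy
    obtain ⟨i, hi⟩ := hx
    obtain ⟨j, hj⟩ := hy
    simp only [mem_iUnion, mem_univ, iff_true]
    exact ⟨(i, j), hi, hj⟩
  bijOn p := by
    refine InjOn.bijOn_image ?_
    rintro ⟨x, y⟩ ⟨hx, hy⟩ ⟨x', y'⟩ ⟨hx', hy'⟩ h
    have h1 : S.chart p.1 x = S.chart p.1 x' := by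
      ext k
      simpa using congrFun h (Fin.castAdd _ k)
    have h2 : T.chart p.2 y = T.chart p.2 y' := by
      ext k
      simpa using congrFun h (Fin.natAdd _ k)
    exact Prod.ext ((S.bijOn _).injOn hx hx' h1) ((T.bijOn _).injOn hy hy' h2)
  definable_target p := by
    refine dfn_append_image_prod ?_ ?_
    · rw [(S.bijOn _).image_eq]
      exact S.definable_target _
    · rw [(T.bijOn _).image_eq]
      exact T.definable_target _
  definable_overlap p q := by
    rw [prod_inter_prod]
    exact dfn_append_image_prod (S.definable_overlap _ _) (T.definable_overlap _ _)
  relOpen_overlap p q := by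
    obtain ⟨U, hU, hSU⟩ := S.relOpen_overlap p.1 q.1
    obtain ⟨V, hV, hTV⟩ := T.relOpen_overlap p.2 q.2
    refine ⟨((fun v : Fin (S.dim p.1 + T.dim p.2) → R => v ∘ Fin.castAdd _) ⁻¹' U) ∩
      ((fun v : Fin (S.dim p.1 + T.dim p.2) → R => v ∘ Fin.natAdd _) ⁻¹' V),
      (hU.preimage (by fun_prop)).inter (hV.preimage (by fun_prop)), ?_⟩
    rw [prod_inter_prod, append_image_prod, append_image_prod, hSU, hTV, (S.bijOn _).image_eq,
      (T.bijOn _).image_eq, preimage_inter, preimage_inter]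
    ext v
    simp only [mem_inter_iff]
    tauto
  definable_transition p q := by
    have h1 := (S.definable_transition p.1 q.1).preimage_comp
      (Sum.map (Fin.castAdd (T.dim p.2)) (Fin.castAdd (T.dim q.2)))
    have h2 := (T.definable_transition p.2 q.2).preimage_comp
      (Sum.map (Fin.natAdd (S.dim p.1)) (Fin.natAdd (S.dim q.1)))
    convert! h1.inter h2 using 1
    ext v
    constructor
    · rintro ⟨⟨x, y⟩, ⟨⟨hx, hy⟩, ⟨hx', hy'⟩⟩, rfl⟩
      refine ⟨⟨x, ⟨hx, hx'⟩, ?_⟩, ⟨y, ⟨hy, hy'⟩, ?_⟩⟩ <;> ext (k | k) <;> simp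
    · rintro ⟨⟨x, ⟨hx, hx'⟩, hxv⟩, ⟨y, ⟨hy, hy'⟩, hyv⟩⟩
      refine ⟨(x, y), ⟨⟨hx, hy⟩, ⟨hx', hy'⟩⟩, ?_⟩
      ext (k | k)
      · refine Fin.addCases (fun k => ?_) (fun k => ?_) k
        · simpa using congrFun hxv (Sum.inl k)
        · simpa using congrFun hyv (Sum.inl k)
      · refine Fin.addCases (fun k => ?_) (fun k => ?_) k
        · simpa using congrFun hxv (Sum.inr k)
        · simpa using congrFun hyv (Sum.inr k)
  continuous_transition p q := by
    obtain ⟨g, hg, hgS⟩ := S.continuous_transition p.1 q.1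
    obtain ⟨h, hh, hhT⟩ := T.continuous_transition p.2 q.2
    refine ⟨fun v => Fin.append (g (v ∘ Fin.castAdd _)) (h (v ∘ Fin.natAdd _)), ?_, ?_⟩
    · rw [prod_inter_prod, append_image_prod]
      refine continuousOn_pi.2 fun k => ?_
      refine Fin.addCases (fun k => ?_) (fun k => ?_) k
      · simp only [Fin.append_left]
        exact (continuousOn_pi.1 hg k).comp
          (f := fun v : Fin (S.dim p.1 + T.dim p.2) → R => v ∘ Fin.castAdd _)
          (Continuous.continuousOn (by fun_prop)) (fun v hv => hv.1)
      · simp only [Fin.append_right]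
        exact (continuousOn_pi.1 hh k).comp
          (f := fun v : Fin (S.dim p.1 + T.dim p.2) → R => v ∘ Fin.natAdd _)
          (Continuous.continuousOn (by fun_prop)) (fun v hv => hv.2)
    · rintro ⟨x, y⟩ ⟨⟨hx, hy⟩, ⟨hx', hy'⟩⟩
      have e1 : Fin.append (S.chart p.1 x) (T.chart p.2 y) ∘ Fin.castAdd _ = S.chart p.1 x := by
        ext k
        simp
      have e2 : Fin.append (S.chart p.1 x) (T.chart p.2 y) ∘ Fin.natAdd _ = T.chart p.2 y := by
        ext k
        simp
      have e3 : g (S.chart p.1 x) = S.chart q.1 x := hgS x ⟨hx, hx'⟩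
      have e4 : h (T.chart p.2 y) = T.chart q.2 y := hhT y ⟨hy, hy'⟩
      simp only [e1, e2, e3, e4]

/-- The restriction of `θ` to `X ⊆ M` is a definable map: its graph is a definable subspace of the
product space. -/
def IsDefinableMapOn (S : LocDefSpace L R M ι) (T : LocDefSpace L R N κ) (θ : M → N)
    (X : Set M) : Prop :=
  (S.prod T).IsDefinableSubspace ((fun x => (x, θ x)) '' X)

/-- Locally definable maps. -/
def IsLDMap (S : LocDefSpace L R M ι) (T : LocDefSpace L R N κ) (θ : M → N) : Prop :=
  ∀ i, T.IsDefinableSubspace (θ '' S.dom i) ∧ IsDefinableMapOn S T θ (S.dom i)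

/-- The restriction of `θ` to `X ⊆ M` is a definable homeomorphism of `X` onto `Y ⊆ N`, both
being definable subspaces with the subspace topologies. -/
def IsDefinableHomeoOn (S : LocDefSpace L R M ι) (T : LocDefSpace L R N κ) (θ : M → N)
    (X : Set M) (Y : Set N) : Prop :=
  S.IsDefinableSubspace X ∧ T.IsDefinableSubspace Y ∧ IsDefinableMapOn S T θ X ∧
    letI := S.topology
    letI := T.topology
    ∃ e : X ≃ₜ Y, ∀ x : X, (e x : N) = θ x

end Prod

section Covering

variable {L : FirstOrder.Language.{u, v}} {R : Type*} [Field R] [LinearOrder R] [IsStrictOrderedRing R]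
  [TopologicalSpace R] [L.Structure R] [OMinimalExpansion L R]

theorem dfn_coord_lt {n : ℕ} (k : Fin n) (c : R) : Dfn L {v : Fin n → R | v k < c} := by
  have h1 : Dfn L {v : Fin n ⊕ Fin 1 → R | v (Sum.inl k) < v (Sum.inr 0)} := by
    have := (OMinimalExpansion.definable_lt (L := L) (R := R)).preimage_comp
      (![Sum.inl k, Sum.inr 0] : Fin 2 → Fin n ⊕ Fin 1)
    simpa [Set.preimage, Function.comp_def] using this
  have h2 := (Set.Definable.singleton_of_mem L (mem_univ c)).preimage_comp
    (Sum.inr : Fin 1 → Fin n ⊕ Fin 1)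
  have h3 := (h1.inter h2).exists_of_finite
  convert! h3 using 1
  ext v
  simp only [mem_ofPred_eq, mem_inter_iff, mem_preimage, mem_singleton_iff, Sum.elim_inl,
    Sum.elim_inr, Function.comp_apply]
  exact ⟨fun h => ⟨fun _ => c, h, rfl⟩, fun ⟨u, h, hu⟩ => hu ▸ h⟩

theorem dfn_lt_coord {n : ℕ} (k : Fin n) (c : R) : Dfn L {v : Fin n → R | c < v k} := by
  have h1 : Dfn L {v : Fin n ⊕ Fin 1 → R | v (Sum.inr 0) < v (Sum.inl k)} := by
    have := (OMinimalExpansion.definable_lt (L := L) (R := R)).preimage_comp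
      (![Sum.inr 0, Sum.inl k] : Fin 2 → Fin n ⊕ Fin 1)
    simpa [Set.preimage, Function.comp_def] using this
  have h2 := (Set.Definable.singleton_of_mem L (mem_univ c)).preimage_comp
    (Sum.inr : Fin 1 → Fin n ⊕ Fin 1)
  have h3 := (h1.inter h2).exists_of_finite
  convert! h3 using 1
  ext v
  simp only [mem_ofPred_eq, mem_inter_iff, mem_preimage, mem_singleton_iff, Sum.elim_inl,
    Sum.elim_inr, Function.comp_apply]
  exact ⟨fun h => ⟨fun _ => c, h, rfl⟩, fun ⟨u, h, hu⟩ => hu ▸ h⟩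

variable (L R) in
theorem dfn_unitInterval : Dfn L {v : Fin 1 → R | 0 ≤ v 0 ∧ v 0 ≤ 1} := by
  have h := (dfn_coord_lt (L := L) (0 : Fin 1) (0 : R)).compl.inter
    (dfn_lt_coord (L := L) (0 : Fin 1) (1 : R)).compl
  convert! h using 1
  ext v
  simp

variable (L R) in
/-- The interval `[0, 1]` of `R` as a locally definable space with one chart, the inclusion
into `R`. -/
def unitInterval : LocDefSpace L R (Set.Icc (0 : R) 1) Unit where
  dom _ := Set.univ
  dim _ := 1
  target _ := {v | 0 ≤ v 0 ∧ v 0 ≤ 1}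
  chart _ t := fun _ => t
  iUnion_dom := iUnion_const _
  bijOn _ := by
    refine ⟨fun t _ => t.2, fun s _ t _ h => Subtype.ext (congrFun h 0), fun v hv => ?_⟩
    refine ⟨⟨v 0, hv⟩, mem_univ _, ?_⟩
    ext k
    rw [Subsingleton.elim k 0]
  definable_target _ := dfn_unitInterval L R
  definable_overlap _ _ := by
    convert! dfn_unitInterval L R using 1
    ext v
    constructor
    · rintro ⟨t, -, rfl⟩
      exact t.2
    · intro hv
      refine ⟨⟨v 0, hv⟩, ⟨mem_univ _, mem_univ _⟩, ?_⟩
      ext k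
      rw [Subsingleton.elim k 0]
  relOpen_overlap _ _ := by
    refine ⟨Set.univ, isOpen_univ, ?_⟩
    ext v
    constructor
    · rintro ⟨t, -, rfl⟩
      exact ⟨t.2, mem_univ _⟩
    · rintro ⟨hv, -⟩
      refine ⟨⟨v 0, hv⟩, ⟨mem_univ _, mem_univ _⟩, ?_⟩
      ext k
      rw [Subsingleton.elim k 0]
  definable_transition _ _ := by
    have h1 := (dfn_unitInterval L R).preimage_comp (Sum.inl : Fin 1 → Fin 1 ⊕ Fin 1)
    have h2 := (Set.Definable.diagonal L (Set.univ : Set R)).preimage_comp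
      (![Sum.inl 0, Sum.inr 0] : Fin 2 → Fin 1 ⊕ Fin 1)
    convert! h1.inter h2 using 1
    ext v
    constructor
    · rintro ⟨t, -, rfl⟩
      exact ⟨t.2, rfl⟩
    · rintro ⟨hv, hv'⟩
      refine ⟨⟨v (Sum.inl 0), hv⟩, ⟨mem_univ _, mem_univ _⟩, ?_⟩
      ext (k | k)
      · rw [Subsingleton.elim k 0]
        rfl
      · rw [Subsingleton.elim k 0]
        exact hv'
  continuous_transition _ _ := ⟨id, continuousOn_id, fun _ _ => rfl⟩

variable {M ι N κ : Type*}

/-- An ld-path in `M`: a continuous ld-map `[0, 1] → M`. -/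
def IsLDPath (S : LocDefSpace L R M ι) (α : Set.Icc (0 : R) 1 → M) : Prop :=
  Continuous[(unitInterval L R).topology, S.topology] α ∧ IsLDMap (unitInterval L R) S α

/-- The points that can be joined to `x` by an ld-path that stays in `Y`. -/
def pathComponentIn (S : LocDefSpace L R M ι) (Y : Set M) (x : M) : Set M :=
  {y | ∃ α : Set.Icc (0 : R) 1 → M, IsLDPath S α ∧ (∀ t, α t ∈ Y) ∧
    α ⟨0, le_rfl, zero_le_one⟩ = x ∧ α ⟨1, zero_le_one, le_rfl⟩ = y}

/-- `θ` is an ld-covering map: a surjective continuous ld-map with an admissible family `𝒪` of open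
definable subspaces of `N`. The connected components of `θ⁻¹(O)` are the path components, taken with
respect to ld-paths, of its points. -/
structure IsLDCoveringMap (S : LocDefSpace L R M ι) (T : LocDefSpace L R N κ) (θ : M → N) :
    Prop where
  surjective : Function.Surjective θ
  continuous : Continuous[S.topology, T.topology] θ
  isLDMap : IsLDMap S T θ
  exists_admissible : ∃ 𝒪 : Set (Set N),
    (∀ O ∈ 𝒪, IsOpen[T.topology] O ∧ T.IsDefinableSubspace O) ∧
    ⋃₀ 𝒪 = Set.univ ∧
    (∀ j, ∃ F ⊆ 𝒪, F.Finite ∧ T.dom j ⊆ ⋃₀ F) ∧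
    ∀ O ∈ 𝒪, ∀ x ∈ θ ⁻¹' O,
      IsDefinableHomeoOn S T θ (pathComponentIn S (θ ⁻¹' O) x) O

end Covering

end LocDefSpace

/-! Definability of `θ '' C` is a finite computation in charts: `C` lies in finitely many charts,
each chart image under `θ` meets finitely many charts that suffice to cover it, and transition maps
and graphs are definable (`IsDefinableSubspace.image`).

For closedness, let `y` be in the closure of `θ '' C`. Sequences are replaced by a definable curve:
`exists_curve_of_mem_closure` yields `γ t ∈ C` for `t > 0`, in a single chart and continuous there
for small `t`, with `θ (γ t) → y` as `t → 0`. Choose an admissible open `O ∋ y`. For small `t` the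
curve lies in `θ ⁻¹' O`, and being connected by ld-paths it stays in one component `D`. Since `θ`
maps `D` homeomorphically onto `O`, there is `x ∈ D` over `y`, and `γ t → x`. As `C` is closed, `x ∈
C`, so `y ∈ θ '' C`.

The curve needs two facts from o-minimality: definable choice (`exists_dfnFun_choice_block`), and
continuity of a one-variable definable function on some interval to the right of each point
(`exists_continuousAt_right`). The latter is obtained without the monotonicity theorem, from a
Baire-type statement for definable families (`exists_interval_of_antitone_family`) which makes
pointwise jumps uniform. -/

/-! ### Calculus of definable predicates and functions. -/

section Definability

variable {L : FirstOrder.Language.{u, v}} {R : Type*} [L.Structure R] {α β : Type*}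

/-- A function of several variables that is definable with parameters. -/
abbrev DfnFun (L : FirstOrder.Language.{u, v}) {R : Type*} [L.Structure R] {α : Type*}
    (f : (α → R) → R) : Prop :=
  (Set.univ : Set R).DefinableFun L f

/-- A predicate in several variables that is definable with parameters. -/
def DfnPred (L : FirstOrder.Language.{u, v}) {R : Type*} [L.Structure R] {α : Type*}
    (P : (α → R) → Prop) : Prop :=
  Dfn L {v | P v}

namespace DfnPred

theorem and {P Q : (α → R) → Prop} (hP : DfnPred L P) (hQ : DfnPred L Q) :
    DfnPred L fun v => P v ∧ Q v :=
  Set.Definable.inter hP hQ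

theorem or {P Q : (α → R) → Prop} (hP : DfnPred L P) (hQ : DfnPred L Q) :
    DfnPred L fun v => P v ∨ Q v :=
  Set.Definable.union hP hQ

theorem not {P : (α → R) → Prop} (hP : DfnPred L P) : DfnPred L fun v => ¬ P v :=
  Set.Definable.compl hP

theorem imp {P Q : (α → R) → Prop} (hP : DfnPred L P) (hQ : DfnPred L Q) :
    DfnPred L fun v => P v → Q v := by
  convert! hP.not.or hQ using 2
  exact imp_iff_not_or

theorem exists_block [Finite β] {P : (α → R) → (β → R) → Prop}
    (hP : DfnPred L fun w : α ⊕ β → R => P (fun a => w (.inl a)) fun b => w (.inr b)) :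
    DfnPred L fun v => ∃ y, P v y :=
  Set.Definable.exists_of_finite hP

theorem exists_elem {P : (α → R) → R → Prop}
    (hP : DfnPred L fun w : α ⊕ Unit → R => P (fun a => w (.inl a)) (w (.inr ()))) :
    DfnPred L fun v => ∃ y, P v y := by
  convert! exists_block (P := fun v (y : Unit → R) => P v (y ())) hP using 2
  exact ⟨fun ⟨y, hy⟩ => ⟨fun _ => y, hy⟩, fun ⟨y, hy⟩ => ⟨y (), hy⟩⟩

theorem forall_elem {P : (α → R) → R → Prop}
    (hP : DfnPred L fun w : α ⊕ Unit → R => P (fun a => w (.inl a)) (w (.inr ()))) :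
    DfnPred L fun v => ∀ y, P v y := by
  convert! (exists_elem (P := fun v y => ¬ P v y) hP.not).not using 2
  simp

theorem forall_finite {κ : Type*} [Finite κ] {P : κ → (α → R) → Prop}
    (hP : ∀ k, DfnPred L (P k)) : DfnPred L fun v => ∀ k, P k v := by
  have e : {v | ∀ k, P k v} = ⋂ k, {v | P k v} := by
    ext v
    simp
  rw [DfnPred, e]
  exact Set.definable_iInter_of_finite hP

theorem exists_finite {κ : Type*} [Finite κ] {P : κ → (α → R) → Prop}
    (hP : ∀ k, DfnPred L (P k)) : DfnPred L fun v => ∃ k, P k v := by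
  have e : {v | ∃ k, P k v} = ⋃ k, {v | P k v} := by
    ext v
    simp
  rw [DfnPred, e]
  exact Set.definable_iUnion_of_finite hP

theorem comp [Finite β] {P : (β → R) → Prop} (hP : DfnPred L P) {F : (α → R) → β → R}
    (hF : ∀ b, DfnFun L fun v => F v b) : DfnPred L fun v => P (F v) :=
  Set.Definable.preimage_map hF hP

theorem mem [Finite β] {s : Set (β → R)} (hs : Dfn L s) {F : (α → R) → β → R}
    (hF : ∀ b, DfnFun L fun v => F v b) : DfnPred L fun v => F v ∈ s :=
  Set.Definable.preimage_map hF hs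

/-- Substitution in a definable family. -/
theorem comp_family {γ : Type*} [Finite α] [Finite β] {P : (α → R) → (β → R) → Prop}
    (hP : DfnPred L fun w : α ⊕ β → R => P (fun a => w (.inl a)) fun b => w (.inr b))
    {f : (γ → R) → α → R} {g : (γ → R) → β → R} (hf : ∀ a, DfnFun L fun v => f v a)
    (hg : ∀ b, DfnFun L fun v => g v b) : DfnPred L fun v => P (f v) (g v) :=
  hP.comp (F := fun v => Sum.elim (f v) (g v)) (by rintro (a | b) <;> simp [hf, hg])

theorem comp_elem {γ : Type*} [Finite α] {P : (α → R) → R → Prop}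
    (hP : DfnPred L fun w : α ⊕ Unit → R => P (fun a => w (.inl a)) (w (.inr ())))
    {f : (γ → R) → α → R} {g : (γ → R) → R} (hf : ∀ a, DfnFun L fun v => f v a)
    (hg : DfnFun L g) : DfnPred L fun v => P (f v) (g v) :=
  hP.comp (F := fun v => Sum.elim (f v) fun _ => g v) (by rintro (a | b) <;> simp [hf, hg])

/-- Substitution in a definable subset of the line. -/
theorem mem_line {s : Set R} (hs : (Set.univ : Set R).Definable₁ L s) {f : (α → R) → R}
    (hf : DfnFun L f) : DfnPred L fun v => f v ∈ s :=
  comp (P := fun w : Fin 1 → R => w 0 ∈ s) hs (F := fun v _ => f v) fun _ => hf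

/-- Substitution in a binary definable relation. -/
theorem comp_rel {A : R → R → Prop} (hA : DfnPred L fun v : Fin 2 → R => A (v 0) (v 1))
    {f g : (α → R) → R} (hf : DfnFun L f) (hg : DfnFun L g) :
    DfnPred L fun v => A (f v) (g v) :=
  hA.comp (F := fun v => ![f v, g v]) (by intro b; fin_cases b <;> simpa)

theorem eq {f g : (α → R) → R} (hf : DfnFun L f) (hg : DfnFun L g) :
    DfnPred L fun v => f v = g v :=
  hf.ofPred_eq hg

end DfnPred

namespace DfnFun

theorem var (i : α) : DfnFun L fun v : α → R => v i :=
  Set.DefinableFun.proj L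

theorem const (c : R) : DfnFun L fun _ : α → R => c :=
  L.definableFun_const α (mem_univ c)

/-- Reindexes the graph from `Option α` to `α ⊕ Unit`, the index type that the quantifier rules
produce. -/
theorem of_graph {f : (α → R) → R}
    (h : DfnPred L fun w : α ⊕ Unit → R => w (.inr ()) = f fun a => w (.inl a)) : DfnFun L f := by
  have e : f.tupleGraph = {w : Option α → R | w none = f fun a => w (some a)} := by
    ext w
    exact eq_comm
  rw [DfnFun, Set.DefinableFun, e]
  exact Set.Definable.preimage_comp (Sum.elim some fun _ => none : α ⊕ Unit → Option α) h

/-- Substitution in a definable function of one variable. -/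
theorem comp_line {f : R → R} (hf : DfnFun L fun v : Fin 1 → R => f (v 0)) {g : (α → R) → R}
    (hg : DfnFun L g) : DfnFun L fun v => f (g v) :=
  Set.DefinableFun.comp (g := fun v _ => g v) (fun _ => hg) hf

variable [Field R] [LinearOrder R] [OMinimalExpansion L R]

theorem add {f g : (α → R) → R} (hf : DfnFun L f) (hg : DfnFun L g) :
    DfnFun L fun v => f v + g v := by
  have h : DfnFun L fun v : Fin 2 → R => v 0 + v 1 := by
    refine of_graph ?_
    convert! DfnPred.comp (P := fun v : Fin 3 → R => v 0 + v 1 = v 2)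
      (OMinimalExpansion.definable_add (L := L) (R := R))
      (F := fun w : Fin 2 ⊕ Unit → R => ![w (.inl 0), w (.inl 1), w (.inr ())])
      (by intro b; fin_cases b <;> exact var _) using 2
    simp [eq_comm]
  exact Set.DefinableFun.comp (g := fun v => ![f v, g v]) (by intro b; fin_cases b <;> simpa) h

theorem mul {f g : (α → R) → R} (hf : DfnFun L f) (hg : DfnFun L g) :
    DfnFun L fun v => f v * g v := by
  have h : DfnFun L fun v : Fin 2 → R => v 0 * v 1 := by
    refine of_graph ?_
    convert! DfnPred.comp (P := fun v : Fin 3 → R => v 0 * v 1 = v 2)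
      (OMinimalExpansion.definable_mul (L := L) (R := R))
      (F := fun w : Fin 2 ⊕ Unit → R => ![w (.inl 0), w (.inl 1), w (.inr ())])
      (by intro b; fin_cases b <;> exact var _) using 2
    simp [eq_comm]
  exact Set.DefinableFun.comp (g := fun v => ![f v, g v]) (by intro b; fin_cases b <;> simpa) h

theorem neg {f : (α → R) → R} (hf : DfnFun L f) : DfnFun L fun v => - f v := by
  simpa using (const (-1 : R)).mul hf

theorem sub {f g : (α → R) → R} (hf : DfnFun L f) (hg : DfnFun L g) :
    DfnFun L fun v => f v - g v := by
  simpa [sub_eq_add_neg] using hf.add hg.neg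

end DfnFun

namespace DfnPred

variable [Field R] [LinearOrder R] [OMinimalExpansion L R]

theorem lt {f g : (α → R) → R} (hf : DfnFun L f) (hg : DfnFun L g) :
    DfnPred L fun v => f v < g v :=
  comp_rel (A := fun x y => x < y) (OMinimalExpansion.definable_lt (L := L) (R := R)) hf hg

theorem le {f g : (α → R) → R} (hf : DfnFun L f) (hg : DfnFun L g) :
    DfnPred L fun v => f v ≤ g v := by
  simpa using (lt hg hf).not

end DfnPred

end Definability

/-! ### Definable subsets of the line. -/

section OMinimal

variable {L : FirstOrder.Language.{u, v}} {R : Type*} [L.Structure R]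

variable (L) in
/-- Definable subsets of the line. -/
abbrev DfnSet (s : Set R) : Prop := (Set.univ : Set R).Definable₁ L s

theorem DfnSet.of_pred {P : R → Prop} (h : DfnPred L fun v : Fin 1 → R => P (v 0)) :
    DfnSet L {x | P x} := h

theorem DfnSet.inter {s t : Set R} (hs : DfnSet L s) (ht : DfnSet L t) : DfnSet L (s ∩ t) :=
  Set.Definable.inter hs ht

variable [Field R] [LinearOrder R] [OMinimalExpansion L R]

/-- Induction principle for definable subsets of the line. -/
theorem DfnSet.induction {s : Set R} (hs : DfnSet L s) {G : Set R → Prop} (empty : G ∅)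
    (basic : ∀ I, IsPointOrInterval I → G I) (union : ∀ a b, G a → G b → G (a ∪ b)) : G s := by
  obtain ⟨F, hF, hI, rfl⟩ := OMinimalExpansion.ominimal (L := L) s hs
  clear hs
  induction F, hF using Set.Finite.induction_on with
  | empty => simpa using empty
  | @insert a t _ _ ih =>
    rw [sUnion_insert]
    exact union _ _ (basic _ (hI _ (mem_insert _ _)))
      (ih fun I hI' => hI _ (mem_insert_of_mem _ hI'))

/-- Reflection carries right-hand germs to left-hand ones and suprema to infima. -/
theorem DfnSet.neg {s : Set R} (hs : DfnSet L s) : DfnSet L {x | -x ∈ s} :=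
  DfnSet.of_pred (DfnPred.mem_line hs (DfnFun.neg (DfnFun.var 0)))

variable (L) in
theorem dfnSet_Ioo (a b : R) : DfnSet L (Ioo a b) :=
  DfnSet.of_pred ((DfnPred.lt (DfnFun.const a) (DfnFun.var 0)).and
    (DfnPred.lt (DfnFun.var 0) (DfnFun.const b)))

/-- A definable set that is unbounded below contains a ray. -/
theorem DfnSet.exists_Iio_subset {s : Set R} (hs : DfnSet L s) (h : ¬ BddBelow s) :
    ∃ b, Iio b ⊆ s := by
  revert h
  refine hs.induction (G := fun s => ¬ BddBelow s → ∃ b, Iio b ⊆ s) ?_ ?_ ?_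
  · intro h
    exact absurd bddBelow_empty h
  · rintro _ (c | ⟨c, d⟩ | d | c) h
    · exact absurd (bddBelow_singleton) h
    · exact absurd bddBelow_Ioo h
    · exact ⟨d, subset_rfl⟩
    · exact absurd bddBelow_Ioi h
    · exact ⟨0, subset_univ _⟩
  · intro s t hs ht h
    by_cases h' : BddBelow s
    · obtain ⟨b, hb⟩ := ht fun h'' => h (h'.union h'')
      exact ⟨b, hb.trans subset_union_right⟩
    · obtain ⟨b, hb⟩ := hs h'
      exact ⟨b, hb.trans subset_union_left⟩

variable [IsStrictOrderedRing R]

/-- To the right of each point, a definable set is eventually everything or nothing. -/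
theorem DfnSet.right_germ {s : Set R} (hs : DfnSet L s) (a : R) :
    (∃ b > a, Ioo a b ⊆ s) ∨ ∃ b > a, Ioo a b ⊆ sᶜ := by
  refine hs.induction (G := fun s => (∃ b > a, Ioo a b ⊆ s) ∨ ∃ b > a, Ioo a b ⊆ sᶜ) ?_ ?_ ?_
  · exact .inr ⟨a + 1, by simp, by simp⟩
  · have far : ∀ c, ∃ b > a, ∀ x ∈ Ioo a b, c ≤ a ∨ x < c := by
      intro c
      rcases le_or_gt c a with h | h
      · exact ⟨a + 1, by simp, fun _ _ => .inl h⟩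
      · exact ⟨c, h, fun x hx => .inr hx.2⟩
    rintro _ (c | ⟨c, d⟩ | d | c)
    · obtain ⟨b, hb, h⟩ := far c
      refine .inr ⟨b, hb, fun x hx => ?_⟩
      have := h x hx
      have := hx.1
      simp only [mem_compl_iff, mem_singleton_iff]
      grind
    · obtain ⟨b, hb, h⟩ := far c
      obtain ⟨b', hb', h'⟩ := far d
      by_cases hc : c ≤ a ∧ a < d
      · refine .inl ⟨b', hb', fun x hx => ?_⟩
        have := h' x hx
        have := hx.1
        simp only [mem_Ioo]
        grind
      · refine .inr ⟨b, hb, fun x hx => ?_⟩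
        have := h x hx
        have := hx.1
        simp only [mem_compl_iff, mem_Ioo]
        grind
    · obtain ⟨b', hb', h'⟩ := far d
      by_cases hc : a < d
      · refine .inl ⟨b', hb', fun x hx => ?_⟩
        have := h' x hx
        simp only [mem_Iio]
        grind
      · refine .inr ⟨b', hb', fun x hx => ?_⟩
        have := hx.1
        simp only [mem_compl_iff, mem_Iio]
        grind
    · obtain ⟨b, hb, h⟩ := far c
      by_cases hc : c ≤ a
      · refine .inl ⟨b, hb, fun x hx => ?_⟩
        have := hx.1
        simp only [mem_Ioi]
        grind
      · refine .inr ⟨b, hb, fun x hx => ?_⟩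
        have := h x hx
        simp only [mem_compl_iff, mem_Ioi]
        grind
    · exact .inl ⟨a + 1, by simp, subset_univ _⟩
  · rintro s t (⟨b, hb, h⟩ | ⟨b, hb, h⟩) (⟨c, hc, h'⟩ | ⟨c, hc, h'⟩)
    · exact .inl ⟨b, hb, h.trans subset_union_left⟩
    · exact .inl ⟨b, hb, h.trans subset_union_left⟩
    · exact .inl ⟨c, hc, h'.trans subset_union_right⟩
    · refine .inr ⟨min b c, lt_min hb hc, fun x hx => ?_⟩
      rw [compl_union]
      exact ⟨h ⟨hx.1, hx.2.trans_le (min_le_left _ _)⟩, h' ⟨hx.1, hx.2.trans_le (min_le_right _ _)⟩⟩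

/-- To the left of each point, a definable set is eventually everything or nothing. -/
theorem DfnSet.left_germ {s : Set R} (hs : DfnSet L s) (a : R) :
    (∃ b < a, Ioo b a ⊆ s) ∨ ∃ b < a, Ioo b a ⊆ sᶜ := by
  refine (hs.neg.right_germ (-a)).imp ?_ ?_ <;>
  · rintro ⟨b, hb, h⟩
    refine ⟨-b, by linarith, fun x hx => ?_⟩
    simpa using h (show -x ∈ Ioo (-a) b from ⟨by linarith [hx.2], by linarith [hx.1]⟩)

/-- A definable set without interior is finite. -/
theorem DfnSet.finite_of_no_interval {s : Set R} (hs : DfnSet L s)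
    (h : ∀ a b, a < b → ¬ Ioo a b ⊆ s) : s.Finite := by
  revert h
  refine hs.induction (G := fun s => (∀ a b, a < b → ¬ Ioo a b ⊆ s) → s.Finite) ?_ ?_ ?_
  · simp
  · rintro _ (c | ⟨c, d⟩ | d | c) h
    · exact finite_singleton _
    · rw [Ioo_eq_empty fun hcd => h c d hcd subset_rfl]
      exact finite_empty
    · exact absurd (fun x hx => hx.2) (h (d - 1) d (by simp))
    · exact absurd (fun x hx => hx.1) (h c (c + 1) (by simp))
    · exact absurd (subset_univ _) (h 0 1 zero_lt_one)
  · intro s t hs ht h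
    exact (hs fun a b hab h' => h a b hab (h'.trans subset_union_left)).union
      (ht fun a b hab h' => h a b hab (h'.trans subset_union_right))

theorem DfnSet.exists_Ioo_subset {s : Set R} (hs : DfnSet L s) (h : s.Infinite) :
    ∃ a b, a < b ∧ Ioo a b ⊆ s := by
  by_contra! h'
  exact h (hs.finite_of_no_interval h')

/-- Definable completeness. -/
theorem DfnSet.exists_isLUB {s : Set R} (hs : DfnSet L s) (hne : s.Nonempty) (hb : BddAbove s) :
    ∃ c, IsLUB s c := by
  revert hne hb
  refine hs.induction (G := fun s => s.Nonempty → BddAbove s → ∃ c, IsLUB s c) ?_ ?_ ?_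
  · rintro ⟨_, ⟨⟩⟩
  · rintro _ (c | ⟨c, d⟩ | d | c) hne hb
    · exact ⟨c, isLUB_singleton⟩
    · exact ⟨d, isLUB_Ioo (nonempty_Ioo.1 hne)⟩
    · exact ⟨d, isLUB_Iio⟩
    · exact absurd hb (not_bddAbove_Ioi c)
    · exact absurd hb not_bddAbove_univ
  · intro s t hs ht hne hb
    -- An empty part has no supremum in `R`, so it is discarded before the two suprema are combined.
    rcases s.eq_empty_or_nonempty with rfl | hs'
    · simpa using ht (by simpa using hne) (by simpa using hb)
    rcases t.eq_empty_or_nonempty with rfl | ht'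
    · simpa using hs (by simpa using hne) (by simpa using hb)
    obtain ⟨c, hc⟩ := hs hs' (hb.mono subset_union_left)
    obtain ⟨d, hd⟩ := ht ht' (hb.mono subset_union_right)
    exact ⟨_, hc.union hd⟩

theorem DfnSet.exists_isGLB {s : Set R} (hs : DfnSet L s) (hne : s.Nonempty) (hb : BddBelow s) :
    ∃ c, IsGLB s c := by
  obtain ⟨x, hx⟩ := hne
  obtain ⟨m, hm⟩ := hb
  obtain ⟨c, hc⟩ := hs.neg.exists_isLUB ⟨-x, by simpa⟩
    ⟨-m, fun y hy => by have := hm hy; linarith⟩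
  refine ⟨-c, fun y hy => ?_, fun y hy => ?_⟩
  · have := hc.1 (show -y ∈ {x | -x ∈ s} by simpa)
    linarith
  · have := hc.2 (show -y ∈ upperBounds {x | -x ∈ s} from fun z hz => by
      have := hy hz; linarith)
    linarith

/-- A definable set that accumulates at `p` from the right contains an interval `(p, b)`. -/
theorem DfnSet.exists_Ioo_right {s : Set R} (hs : DfnSet L s) {p : R}
    (h : ∀ b > p, (s ∩ Ioo p b).Nonempty) : ∃ b > p, Ioo p b ⊆ s := by
  refine (hs.right_germ p).resolve_right ?_
  rintro ⟨b, hb, hsub⟩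
  obtain ⟨x, hx, hx'⟩ := h b hb
  exact hsub hx' hx

end OMinimal

/-! ### Definable choice. -/

section Choice

variable {R : Type*} [Field R] [LinearOrder R]

/-- A first-order description of a point of a nonempty finite union of points and intervals: its
least element if there is one, and otherwise a point of its leftmost interval. -/
def IsChoicePoint (P : R → Prop) (y : R) : Prop :=
  (P y ∧ ∀ x, P x → y ≤ x) ∨
  (∃ a b, (∀ x, P x → a < x) ∧ a < b ∧ b ≤ a + 1 ∧ (∀ x, a < x → x < b → P x) ∧
    (∀ c, c ≤ a + 1 → (∀ x, a < x → x < c → P x) → c ≤ b) ∧ y + y = a + b) ∨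
  ∃ b, b ≤ 0 ∧ (∀ x, x < b → P x) ∧ (∀ c, c ≤ 0 → (∀ x, x < c → P x) → c ≤ b) ∧ y = b - 1

variable [IsStrictOrderedRing R]

theorem IsChoicePoint.holds {P : R → Prop} {y : R} (h : IsChoicePoint P y) : P y := by
  rcases h with h | ⟨a, b, -, hab, -, h, -, hy⟩ | ⟨b, -, h, -, hy⟩
  · exact h.1
  · exact h y (by linarith) (by linarith)
  · exact h y (by linarith)

theorem IsChoicePoint.unique {P : R → Prop} {y z : R} (hy : IsChoicePoint P y)
    (hz : IsChoicePoint P z) : y = z := by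
  -- A strict lower bound of `P` cannot exceed the left end of an interval inside `P`, so the
  -- leftmost `a` is unique. The next two claims make the three cases of the definition mutually
  -- exclusive.
  have key : ∀ {a b a' b' : R}, (∀ x, P x → a < x) → a' < b' → (∀ x, a' < x → x < b' → P x) →
      a ≤ a' := by
    intro a b a' b' h hab h'
    by_contra! hlt
    obtain ⟨x, hx, hx'⟩ := exists_between (lt_min hlt hab)
    exact (hx'.trans_le (min_le_left _ _)).not_gt (h x (h' x hx (hx'.trans_le (min_le_right _ _))))
  have least_int : ∀ {y a b : R}, P y → (∀ x, P x → y ≤ x) → (∀ x, P x → a < x) → a < b →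
      (∀ x, a < x → x < b → P x) → False := by
    intro y a b hy h ha hab h'
    obtain ⟨x, hx, hx'⟩ := exists_between (lt_min (ha y hy) hab)
    exact (hx'.trans_le (min_le_left _ _)).not_ge (h x (h' x hx (hx'.trans_le (min_le_right _ _))))
  have ray : ∀ {a b : R}, (∀ x, P x → a ≤ x) → (∀ x, x < b → P x) → False := by
    intro a b ha hb
    have := ha (min a b - 1) (hb _ (by linarith [min_le_right a b]))
    linarith [min_le_left a b]
  rcases hy with ⟨hy, h⟩ | ⟨a, b, ha, hab, hb1, h, hb, hy⟩ | ⟨b, hb0, h, hb, hy⟩ <;>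
  rcases hz with ⟨hz, h'⟩ | ⟨a', b', ha', hab', hb1', h', hb', hz⟩ | ⟨b', hb0', h', hb', hz⟩
  · exact le_antisymm (h _ hz) (h' _ hy)
  · exact (least_int hy h ha' hab' h').elim
  · exact (ray h h').elim
  · exact (least_int hz h' ha hab h).elim
  · obtain rfl : a = a' := le_antisymm (key (b := b) ha hab' h') (key (b := b) ha' hab h)
    obtain rfl : b = b' := le_antisymm (hb' _ hb1 h) (hb _ hb1' h')
    linarith
  · exact (ray (fun x hx => (ha x hx).le) h').elim
  · exact (ray h' h).elim
  · exact (ray (fun x hx => (ha' x hx).le) h).elim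
  · obtain rfl : b = b' := le_antisymm (hb' _ hb0 h) (hb _ hb0' h')
    linarith

variable {L : FirstOrder.Language.{u, v}} [L.Structure R] [OMinimalExpansion L R]

/-- If `P` is bounded below, its infimum either satisfies `P` or is the left end of an interval in
`P`, by o-minimality; otherwise `P` contains a ray. The caps `a + 1` and `0` on the right end ensure
that its supremum exists. -/
theorem exists_isChoicePoint {P : R → Prop} (hP : DfnSet L {x | P x}) (hne : ∃ x, P x) :
    ∃ y, IsChoicePoint P y := by
  have hPv : ∀ {β : Type} (g : (β → R) → R), DfnFun L g → DfnPred L fun v => P (g v) :=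
    fun g hg => DfnPred.mem_line hP hg
  by_cases hbdd : BddBelow {x | P x}
  · obtain ⟨a, ha⟩ := hP.exists_isGLB hne hbdd
    by_cases haP : P a
    · exact ⟨a, .inl ⟨haP, fun x hx => ha.1 hx⟩⟩
    have hlt : ∀ x, P x → a < x := fun x hx =>
      lt_of_le_of_ne (ha.1 hx) fun h => haP (h ▸ hx)
    obtain ⟨b₀, hb₀, hsub⟩ := hP.exists_Ioo_right (p := a) fun b hb => by
      obtain ⟨x, hx, hxb⟩ : ∃ x, P x ∧ x < b := by
        by_contra! h
        exact (ha.2 (fun x hx => h x hx)).not_gt hb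
      exact ⟨x, hx, hlt x hx, hxb⟩
    let B : Set R := {b | a < b ∧ b ≤ a + 1 ∧ ∀ x, a < x → x < b → P x}
    have hB : DfnSet L B := by
      refine DfnSet.of_pred (.and (.lt (.const a) (.var 0)) (.and (.le (.var 0) (.const (a + 1)))
        (.forall_elem (.imp ?_ (.imp ?_ (hPv _ (.var _)))))))
      · exact .lt (.const a) (.var _)
      · exact .lt (.var _) (.var _)
    have hmem : min b₀ (a + 1) ∈ B :=
      ⟨lt_min hb₀ (by simp), min_le_right _ _, fun x hx hx' =>
        hsub ⟨hx, hx'.trans_le (min_le_left _ _)⟩⟩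
    obtain ⟨b, hb⟩ := hB.exists_isLUB ⟨_, hmem⟩ ⟨a + 1, fun x hx => hx.2.1⟩
    refine ⟨(a + b) / 2, .inr (.inl ⟨a, b, hlt, hmem.1.trans_le (hb.1 hmem),
      hb.2 fun x hx => hx.2.1, fun x hx hx' => ?_, fun c hc h => ?_, by ring⟩)⟩
    · obtain ⟨c, hc, hxc⟩ : ∃ c ∈ B, x < c := by
        by_contra! h
        exact (hb.2 fun c hc => h c hc).not_gt hx'
      exact hc.2.2 x hx hxc
    · by_cases hac : a < c
      · exact hb.1 ⟨hac, hc, h⟩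
      · exact (not_lt.1 hac).trans (hmem.1.le.trans (hb.1 hmem))
  · obtain ⟨b₀, hb₀⟩ := hP.exists_Iio_subset hbdd
    let B : Set R := {b | b ≤ 0 ∧ ∀ x, x < b → P x}
    have hB : DfnSet L B := by
      refine DfnSet.of_pred (.and (.le (.var 0) (.const 0))
        (.forall_elem (.imp ?_ (hPv _ (.var _)))))
      exact .lt (.var _) (.var _)
    obtain ⟨b, hb⟩ := hB.exists_isLUB
      ⟨min b₀ 0, min_le_right _ _, fun x hx => hb₀ (hx.trans_le (min_le_left _ _))⟩
      ⟨0, fun x hx => hx.1⟩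
    refine ⟨b - 1, .inr (.inr ⟨b, hb.2 fun x hx => hx.1, fun x hx => ?_,
      fun c hc h => hb.1 ⟨hc, h⟩, rfl⟩)⟩
    obtain ⟨c, hc, hxc⟩ : ∃ c ∈ B, x < c := by
      by_contra! h
      exact (hb.2 fun c hc => h c hc).not_gt hx
    exact hc.2 x hxc

/-- Definable choice in one variable. -/
theorem exists_dfnFun_choice {α : Type*} [Finite α] {P : (α → R) → R → Prop}
    (hP : DfnPred L fun w : α ⊕ Unit → R => P (fun a => w (.inl a)) (w (.inr ()))) :
    ∃ f : (α → R) → R, DfnFun L f ∧ ∀ v, (∃ y, P v y) → P v (f v) := by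
  classical
  have hne : ∀ v, (∃ y, P v y) → ∃ y, IsChoicePoint (P v) y := fun v hv =>
    exists_isChoicePoint (L := L)
      (DfnSet.of_pred (hP.comp_elem (fun a => .const (v a)) (.var 0))) hv
  let f : (α → R) → R := fun v => if h : ∃ y, P v y then (hne v h).choose else 0
  have hf : ∀ v, (∃ y, P v y) → IsChoicePoint (P v) (f v) := fun v h => by
    simp only [f, dif_pos h]
    exact (hne v h).choose_spec
  refine ⟨f, ?_, fun v h => (hf v h).holds⟩
  -- Uniqueness of the choice point makes the graph of `f` first-order; empty fibres get the value
  -- `0`.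
  have e : ∀ v y, y = f v ↔ IsChoicePoint (P v) y ∨ (¬ (∃ y, P v y) ∧ y = 0) := by
    intro v y
    by_cases h : ∃ y, P v y
    · simp only [h, not_true, false_and, or_false]
      exact ⟨fun h' => h' ▸ hf v h, fun h' => h'.unique (hf v h)⟩
    · have : ¬ IsChoicePoint (P v) y := fun h' => h ⟨y, h'.holds⟩
      simp [f, h, this]
  refine DfnFun.of_graph ?_
  simp only [e]
  have hPc : ∀ {β : Type _} {g : (β → R) → α → R} {y : (β → R) → R},
      (∀ a, DfnFun L fun v => g v a) → DfnFun L y → DfnPred L fun v => P (g v) (y v) :=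
    fun hg hy => hP.comp_elem hg hy
  unfold IsChoicePoint
  refine .or (.or (.and (hP) (.forall_elem (.imp (hPc (fun a => .var _) (.var _))
    (.le (.var _) (.var _))))) (.or (.exists_elem (.exists_elem (.and ?_ (.and
      (.lt (.var _) (.var _)) (.and (.le (.var _) (.add (.var _) (.const 1)))
      (.and ?_ (.and ?_ (.eq (.add (.var _) (.var _)) (.add (.var _) (.var _)))))))))) ?_)) ?_
  · exact .forall_elem (.imp (hPc (fun a => .var _) (.var _)) (.lt (.var _) (.var _)))
  · exact .forall_elem (.imp (.lt (.var _) (.var _)) (.imp (.lt (.var _) (.var _))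
      (hPc (fun a => .var _) (.var _))))
  · exact .forall_elem (.imp (.le (.var _) (.add (.var _) (.const 1)))
      (.imp (.forall_elem (.imp (.lt (.var _) (.var _)) (.imp (.lt (.var _) (.var _))
      (hPc (fun a => .var _) (.var _))))) (.le (.var _) (.var _))))
  · refine .exists_elem (.and (.le (.var _) (.const 0)) (.and ?_ (.and ?_
      (.eq (.var _) (.sub (.var _) (.const 1))))))
    · exact .forall_elem (.imp (.lt (.var _) (.var _)) (hPc (fun a => .var _) (.var _)))
    · exact .forall_elem (.imp (.le (.var _) (.const 0)) (.imp (.forall_elem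
        (.imp (.lt (.var _) (.var _)) (hPc (fun a => .var _) (.var _)))) (.le (.var _) (.var _))))
  · exact .and (.not (.exists_elem (hPc (fun a => .var _) (.var _)))) (.eq (.var _) (.const 0))

/-- Definable choice in several variables. -/
theorem exists_dfnFun_choice_block {α : Type*} [Finite α] {n : ℕ}
    {P : (α → R) → (Fin n → R) → Prop}
    (hP : DfnPred L fun w : α ⊕ Fin n → R => P (fun a => w (.inl a)) fun b => w (.inr b)) :
    ∃ f : (α → R) → Fin n → R, (∀ k, DfnFun L fun v => f v k) ∧
      ∀ v, (∃ y, P v y) → P v (f v) := by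
  induction n with
  | zero =>
    refine ⟨fun _ => Fin.elim0, fun k => k.elim0, fun v ⟨y, hy⟩ => ?_⟩
    rwa [Subsingleton.elim (Fin.elim0 : Fin 0 → R) y]
  | succ n ih =>
    -- The first coordinate is chosen among those that extend to a solution, the others by induction
    -- with it substituted.
    obtain ⟨g, hg, hgP⟩ := exists_dfnFun_choice (L := L)
      (P := fun v y => ∃ z : Fin n → R, P v (Fin.cons y z)) <| by
        refine .exists_block (hP.comp_family (fun a => .var _) fun b => ?_)
        refine Fin.cases ?_ (fun b => ?_) b
        · exact .var _
        · exact .var _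
    obtain ⟨f, hf, hfP⟩ := ih (P := fun v z => P v (Fin.cons (g v) z)) <| by
      refine hP.comp_family (fun a => .var _) fun b => ?_
      refine Fin.cases ?_ (fun b => ?_) b
      · simp only [Fin.cons_zero]
        exact Set.DefinableFun.comp (fun a => DfnFun.var _) hg
      · exact .var _
    refine ⟨fun v => Fin.cons (g v) (f v), fun k => ?_, fun v ⟨y, hy⟩ => ?_⟩
    · refine Fin.cases ?_ (fun b => ?_) k
      · simpa using hg
      · simpa using hf b
    · exact hfP v (hgP v ⟨y 0, Fin.tail y, by rwa [Fin.cons_self_tail]⟩)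

end Choice

/-! ### Continuity of definable functions of one variable. -/

section Continuity

variable {L : FirstOrder.Language.{u, v}} {R : Type*} [L.Structure R] [Field R] [LinearOrder R]
  [OMinimalExpansion L R] [IsStrictOrderedRing R]

/-- An interval that is the union of an antitone definable family of sets is not the union of
sets without interior. -/
theorem exists_interval_of_antitone_family {A : R → R → Prop}
    (hA : DfnPred L fun v : Fin 2 → R => A (v 0) (v 1))
    (anti : ∀ ε ε' x, ε' ≤ ε → A ε x → A ε' x) {p q : R} (hpq : p < q)
    (cover : ∀ x ∈ Ioo p q, ∃ ε > 0, A ε x) :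
    ∃ ε > 0, ∃ c d, c < d ∧ Ioo c d ⊆ Ioo p q ∧ ∀ x ∈ Ioo c d, A ε x := by
  by_contra! h
  -- If no set of the family contains an interval, each has only finitely many points in `(p, q)`.
  have fin : ∀ ε > 0, ({x | A ε x} ∩ Ioo p q).Finite := fun ε hε => by
    refine DfnSet.finite_of_no_interval (L := L)
      (.inter (.of_pred (hA.comp_rel (.const ε) (.var 0))) (dfnSet_Ioo L p q)) fun a b hab hsub => ?_
    obtain ⟨x, hx, hx'⟩ := h ε hε a b hab fun x hx => (hsub hx).2
    exact hx' (hsub hx).1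
  -- A record is the first point after `p` of some set of the family. Records accumulate at `p`,
  -- since the least point of `A ε` in `(p, q)` is one, so they fill an interval `(p, p')`.
  let records : Set R := {x | ∃ ε, 0 < ε ∧ A ε x ∧ ∀ y, p < y → y < x → ¬ A ε y}
  have hrec : DfnSet L records := by
    refine .of_pred (.exists_elem (.and (.lt (.const 0) (.var _)) (.and
      (hA.comp_rel (.var _) (.var _)) (.forall_elem (.imp (.lt (.const p) (.var _)) (.imp
      (.lt (.var _) (.var _)) (.not (hA.comp_rel (.var _) (.var _)))))))))
  obtain ⟨p', hp', hsub⟩ := hrec.exists_Ioo_right (p := p) fun b hb => by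
    obtain ⟨x, hx, hx'⟩ := exists_between (lt_min hb hpq)
    have hxb := hx'.trans_le (min_le_left _ _)
    have hxq := hx'.trans_le (min_le_right _ _)
    obtain ⟨ε, hε, hεx⟩ := cover x ⟨hx, hxq⟩
    obtain ⟨m, hm, hmin⟩ := exists_min_image _ id (fin ε hε) ⟨x, hεx, hx, hxq⟩
    have hmx : m ≤ x := hmin x ⟨hεx, hx, hxq⟩
    refine ⟨m, ⟨ε, hε, hm.1, fun y hpy hym hy => ?_⟩, hm.2.1, hmx.trans_lt hxb⟩
    exact (hmin y ⟨hy, hpy, hym.trans_le (hmx.trans hxq.le)⟩).not_gt hym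
  obtain ⟨x, hx, hx'⟩ := exists_between (lt_min hp' hpq)
  have hxp' := hx'.trans_le (min_le_left _ _)
  obtain ⟨ε, hε, hεx, -⟩ := hsub ⟨hx, hxp'⟩
  -- Some record `y > x` is missed by `A ε ∋ x`, and `y` is the first point of some `A ε'`. The two
  -- sets are nested: either `x ∈ A ε'` precedes `y`, or `y ∈ A ε`.
  obtain ⟨y, hy, hy'⟩ := h ε hε x (min p' q) hx' fun z hz =>
    ⟨hx.trans hz.1, hz.2.trans_le (min_le_right _ _)⟩
  obtain ⟨ε', hε', hεy, hrecy⟩ := hsub ⟨hx.trans hy.1, hy.2.trans_le (min_le_left _ _)⟩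
  rcases le_total ε' ε with hle | hle
  · exact hrecy x hx hy.1 (anti _ _ _ hle hεx)
  · exact hy' (anti _ _ _ hle hεy)

/-- A definable function does not jump by a fixed amount between any two points of an interval. -/
theorem not_uniform_jump {f : R → R} (hf : DfnFun L fun v : Fin 1 → R => f (v 0)) {c d ε : R}
    (hcd : c < d) (hε : 0 < ε) : ¬ ∀ x t, c < x → x < t → t < d → f x + ε ≤ f t := by
  intro h
  have hinj : InjOn f (Ioo c d) := by
    intro x hx y hy hxy
    rcases lt_trichotomy x y with hlt | rfl | hlt
    · linarith [h x y hx.1 hlt hy.2]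
    · rfl
    · linarith [h y x hy.1 hlt hx.2]
  have hdfn : DfnSet L {y | ∃ x, (c < x ∧ x < d) ∧ y = f x} :=
    .of_pred (.exists_elem (.and (.and (.lt (.const c) (.var _)) (.lt (.var _) (.const d)))
      (.eq (.var _) (hf.comp_line (.var _)))))
  have himg : {y | ∃ x, (c < x ∧ x < d) ∧ y = f x} = f '' Ioo c d := by
    ext y
    simp [eq_comm]
  -- The infinite definable image contains an interval, hence two distinct values less than `ε`
  -- apart.
  obtain ⟨a, b, hab, hsub⟩ := hdfn.exists_Ioo_subset
    (himg ▸ (Ioo_infinite hcd).image hinj)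
  obtain ⟨y, hy, hy'⟩ := exists_between hab
  obtain ⟨z, hz, hz'⟩ := exists_between (lt_min hy' (lt_add_of_pos_right y hε))
  have hzb := hz'.trans_le (min_le_left _ _)
  have hzε := hz'.trans_le (min_le_right _ _)
  obtain ⟨s, hs, rfl⟩ := hsub ⟨hy, hy'⟩
  obtain ⟨t, ht, rfl⟩ := hsub ⟨hy.trans hz, hzb⟩
  rcases lt_trichotomy s t with hlt | rfl | hlt
  · linarith [h s t hs.1 hlt ht.2]
  · exact lt_irrefl _ hz
  · linarith [h t s ht.1 hlt hs.2]

/-- A definable function does not jump upwards by a fixed amount to the right of each point of an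
interval. -/
theorem not_jump_right {f : R → R} (hf : DfnFun L fun v : Fin 1 → R => f (v 0)) {c d ε : R}
    (hcd : c < d) (hε : 0 < ε) :
    ¬ ∀ x ∈ Ioo c d, ∃ δ > 0, ∀ t, x < t → t < x + δ → f x + ε ≤ f t := by
  intro h
  -- A single `δ` serves on a subinterval; shortening it to length at most `δ` makes the jump
  -- uniform between any two of its points.
  obtain ⟨δ, hδ, c', d', hcd', -, h'⟩ := exists_interval_of_antitone_family (L := L)
    (A := fun δ x => ∀ t, x < t → t < x + δ → f x + ε ≤ f t)
    (.forall_elem (.imp (.lt (.var _) (.var _)) (.imp (.lt (.var _) (.add (.var _) (.var _)))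
      (.le (.add (hf.comp_line (.var _)) (.const ε)) (hf.comp_line (.var _))))))
    (fun δ δ' x hle h t hxt ht => h t hxt (by linarith)) hcd h
  refine not_uniform_jump hf (d := min d' (c' + δ)) (lt_min hcd' (by linarith)) hε
    fun x t hx hxt ht => ?_
  have := min_le_left d' (c' + δ)
  have := min_le_right d' (c' + δ)
  exact h' x ⟨hx, by linarith⟩ t hxt (by linarith)

/-- Reflection `x ↦ -x` reduces this to `not_jump_right`. -/
theorem not_jump_left {f : R → R} (hf : DfnFun L fun v : Fin 1 → R => f (v 0)) {c d ε : R}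
    (hcd : c < d) (hε : 0 < ε) :
    ¬ ∀ x ∈ Ioo c d, ∃ δ > 0, ∀ t, x - δ < t → t < x → f x + ε ≤ f t := by
  intro h
  refine not_jump_right (L := L) (f := fun x => f (-x)) (hf.comp_line (.neg (.var 0)))
    (neg_lt_neg hcd) hε fun x hx => ?_
  obtain ⟨δ, hδ, h'⟩ := h (-x) ⟨by linarith [hx.2], by linarith [hx.1]⟩
  exact ⟨δ, hδ, fun t hxt ht => h' (-t) (by linarith) (by linarith)⟩

/-- A definable function is not discontinuous at each point of an interval. -/
theorem not_forall_discontinuous {f : R → R} (hf : DfnFun L fun v : Fin 1 → R => f (v 0))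
    {p q : R} (hpq : p < q) :
    ¬ ∀ x ∈ Ioo p q, ∃ ε > 0, ∀ δ, 0 < δ →
      ∃ t, (x - δ < t ∧ t < x + δ) ∧ (f x + ε ≤ f t ∨ f t + ε ≤ f x) := by
  intro h
  -- The size `ε` of the discontinuity can be taken constant on a subinterval.
  obtain ⟨ε, hε, c, d, hcd, -, h'⟩ := exists_interval_of_antitone_family (L := L)
    (A := fun ε x => ∀ δ, 0 < δ →
      ∃ t, (x - δ < t ∧ t < x + δ) ∧ (f x + ε ≤ f t ∨ f t + ε ≤ f x))
    (.forall_elem (.imp (.lt (.const 0) (.var _)) (.exists_elem (.and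
      (.and (.lt (.sub (.var _) (.var _)) (.var _)) (.lt (.var _) (.add (.var _) (.var _))))
      (.or (.le (.add (hf.comp_line (.var _)) (.var _)) (hf.comp_line (.var _)))
        (.le (.add (hf.comp_line (.var _)) (.var _)) (hf.comp_line (.var _))))))))
    (fun ε ε' x hle h δ hδ => by
      obtain ⟨t, ht, ht'⟩ := h δ hδ
      exact ⟨t, ht, ht'.imp (fun _ => by linarith) fun _ => by linarith⟩) hpq h
  have hnf : DfnFun L fun v : Fin 1 → R => -f (v 0) := hf.neg
  have right : ∀ g : R → R, DfnFun L (fun v : Fin 1 → R => g (v 0)) →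
      {x | ∃ δ, 0 < δ ∧ ∀ t, x < t → t < x + δ → g x + ε ≤ g t}.Finite := fun g hg => by
    refine DfnSet.finite_of_no_interval (L := L) (.of_pred (.exists_elem (.and (.lt (.const 0) (.var _)) (.forall_elem
      (.imp (.lt (.var _) (.var _)) (.imp (.lt (.var _) (.add (.var _) (.var _)))
      (.le (.add (hg.comp_line (.var _)) (.const ε)) (hg.comp_line (.var _))))))))) ?_
    exact fun c d hcd hsub => not_jump_right hg hcd hε fun x hx => hsub hx
  have left : ∀ g : R → R, DfnFun L (fun v : Fin 1 → R => g (v 0)) →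
      {x | ∃ δ, 0 < δ ∧ ∀ t, x - δ < t → t < x → g x + ε ≤ g t}.Finite := fun g hg => by
    refine DfnSet.finite_of_no_interval (L := L) (.of_pred (.exists_elem (.and (.lt (.const 0) (.var _)) (.forall_elem
      (.imp (.lt (.sub (.var _) (.var _)) (.var _)) (.imp (.lt (.var _) (.var _))
      (.le (.add (hg.comp_line (.var _)) (.const ε)) (hg.comp_line (.var _))))))))) ?_
    exact fun c d hcd hsub => not_jump_left hg hcd hε fun x hx => hsub hx
  -- Only finitely many points have a persistent one-sided jump of `f` or `-f`; pick `x` away from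
  -- them. By the germ dichotomy, no jump of size `ε` then occurs near `x` on either side.
  obtain ⟨x, hx, hx'⟩ := ((Ioo_infinite hcd).sdiff (((right f hf).union (right (fun x => -f x) hnf)).union
    ((left f hf).union (left (fun x => -f x) hnf)))).nonempty
  simp only [mem_union, not_or, mem_ofPred_eq] at hx'
  obtain ⟨⟨h1, h2⟩, h3, h4⟩ := hx'
  have hR : ∀ g : R → R, DfnFun L (fun v : Fin 1 → R => g (v 0)) →
      (¬ ∃ δ, 0 < δ ∧ ∀ t, x < t → t < x + δ → g x + ε ≤ g t) →
      ∃ δ > 0, ∀ t, x < t → t < x + δ → ¬ g x + ε ≤ g t := fun g hg hn => by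
    rcases DfnSet.right_germ (L := L) (s := {t | g x + ε ≤ g t})
      (.of_pred (.le (.const _) (hg.comp_line (.var _)))) x with ⟨b, hb, hs⟩ | ⟨b, hb, hs⟩
    · exact (hn ⟨b - x, by linarith, fun t ht ht' => hs ⟨ht, by linarith⟩⟩).elim
    · exact ⟨b - x, by linarith, fun t ht ht' => hs ⟨ht, by linarith⟩⟩
  have hL : ∀ g : R → R, DfnFun L (fun v : Fin 1 → R => g (v 0)) →
      (¬ ∃ δ, 0 < δ ∧ ∀ t, x - δ < t → t < x → g x + ε ≤ g t) →
      ∃ δ > 0, ∀ t, x - δ < t → t < x → ¬ g x + ε ≤ g t := fun g hg hn => by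
    rcases DfnSet.left_germ (L := L) (s := {t | g x + ε ≤ g t})
      (.of_pred (.le (.const _) (hg.comp_line (.var _)))) x with ⟨b, hb, hs⟩ | ⟨b, hb, hs⟩
    · exact (hn ⟨x - b, by linarith, fun t ht ht' => hs ⟨by linarith, ht'⟩⟩).elim
    · exact ⟨x - b, by linarith, fun t ht ht' => hs ⟨by linarith, ht'⟩⟩
  obtain ⟨δ₁, hδ₁, h1⟩ := hR f hf h1
  obtain ⟨δ₂, hδ₂, h2⟩ := hR (fun x => -f x) hnf h2
  obtain ⟨δ₃, hδ₃, h3⟩ := hL f hf h3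
  obtain ⟨δ₄, hδ₄, h4⟩ := hL (fun x => -f x) hnf h4
  obtain ⟨t, ⟨ht, ht'⟩, hjump⟩ := h' x hx (min (min δ₁ δ₂) (min δ₃ δ₄)) (by positivity)
  have hm : min (min δ₁ δ₂) (min δ₃ δ₄) ≤ δ₁ ∧ min (min δ₁ δ₂) (min δ₃ δ₄) ≤ δ₂ ∧
      min (min δ₁ δ₂) (min δ₃ δ₄) ≤ δ₃ ∧ min (min δ₁ δ₂) (min δ₃ δ₄) ≤ δ₄ := by
    simp
  generalize min (min δ₁ δ₂) (min δ₃ δ₄) = δ at *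
  obtain ⟨_, _, _, _⟩ := hm
  rcases lt_trichotomy x t with hlt | rfl | hlt
  · rcases hjump with hj | hj
    · exact h1 t hlt (by linarith) hj
    · exact h2 t hlt (by linarith) (by linarith)
  · rcases hjump with hj | hj <;> linarith
  · rcases hjump with hj | hj
    · exact h3 t (by linarith) hlt hj
    · exact h4 t (by linarith) hlt (by linarith)

variable [TopologicalSpace R] [OrderTopology R]

/-- A definable function of one variable is continuous to the right of each point. -/
theorem exists_continuousAt_right {f : R → R} (hf : DfnFun L fun v : Fin 1 → R => f (v 0))
    (a : R) : ∃ b > a, ∀ x ∈ Ioo a b, ContinuousAt f x := by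
  rcases DfnSet.right_germ (L := L) (s := {x | ∃ ε > 0, ∀ δ, 0 < δ →
      ∃ t, (x - δ < t ∧ t < x + δ) ∧ (f x + ε ≤ f t ∨ f t + ε ≤ f x)})
      (.of_pred (.exists_elem (.and (.lt (.const 0) (.var _))
        (.forall_elem (.imp (.lt (.const 0) (.var _)) (.exists_elem (.and
      (.and (.lt (.sub (.var _) (.var _)) (.var _)) (.lt (.var _) (.add (.var _) (.var _))))
      (.or (.le (.add (hf.comp_line (.var _)) (.var _)) (hf.comp_line (.var _)))
        (.le (.add (hf.comp_line (.var _)) (.var _)) (hf.comp_line (.var _)))))))))))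
    a with ⟨b, hb, h⟩ | ⟨b, hb, h⟩
  · exact (not_forall_discontinuous hf hb fun x hx => h hx).elim
  · refine ⟨b, hb, fun x hx => ?_⟩
    have hx' := h hx
    simp only [mem_compl_iff, mem_ofPred_eq] at hx'
    push Not at hx'
    rw [ContinuousAt, LinearOrderedAddCommGroup.tendsto_nhds]
    intro ε hε
    obtain ⟨δ, hδ, h'⟩ := hx' ε hε
    filter_upwards [Ioo_mem_nhds (sub_lt_self x hδ) (lt_add_of_pos_right x hδ)] with t ht
    obtain ⟨h1, h2⟩ := h' t ht
    rw [abs_lt]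
    constructor <;> linarith

end Continuity

namespace LocDefSpace

/-! ### Definable subspaces and open sets in charts. -/

section Subspaces

variable {L : FirstOrder.Language.{u, v}} {R : Type*} [L.Structure R] [TopologicalSpace R]
  {M ι N κ : Type*} {S : LocDefSpace L R M ι} {T : LocDefSpace L R N κ}

/-- The trace of a definable subspace on any chart is definable. -/
theorem IsDefinableSubspace.dfn_chart_image {X : Set M} (hX : S.IsDefinableSubspace X) (i : ι) :
    Dfn L (S.chart i '' (X ∩ S.dom i)) := by
  obtain ⟨J, hJ, hXJ, hd⟩ := hX
  have := hJ.to_subtype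
  -- The trace on chart `i` is glued from the charts of `J` through the transition graphs;
  -- injectivity of chart `j` identifies the two points involved.
  have e : S.chart i '' (X ∩ S.dom i) = {z | ∃ j : J, ∃ w, w ∈ S.chart j '' (X ∩ S.dom j) ∧
      Sum.elim z w ∈ (fun x => (Sum.elim (S.chart i x) (S.chart j x) :
        Fin (S.dim i) ⊕ Fin (S.dim j) → R)) '' (S.dom i ∩ S.dom j)} := by
    ext z
    constructor
    · rintro ⟨x, ⟨hx, hxi⟩, rfl⟩
      obtain ⟨j, hj, hxj⟩ := mem_iUnion₂.1 (hXJ hx)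
      exact ⟨⟨j, hj⟩, S.chart j x, ⟨x, ⟨hx, hxj⟩, rfl⟩, x, ⟨hxi, hxj⟩, rfl⟩
    · rintro ⟨j, w, ⟨x, ⟨hx, hxj⟩, rfl⟩, x', ⟨hxi', hxj'⟩, h⟩
      have hz : S.chart i x' = z := funext fun k => congrFun h (.inl k)
      have hw : S.chart j x' = S.chart j x := funext fun k => congrFun h (.inr k)
      obtain rfl := (S.bijOn j).injOn hxj' hxj hw
      exact ⟨x', ⟨hx, hxi'⟩, hz⟩
  rw [e]
  refine DfnPred.exists_finite fun j => .exists_block (.and (.mem (hd j j.2) fun b => .var _)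
    (.mem (S.definable_transition i j) ?_))
  rintro (b | b) <;> exact .var _

theorem isDefinableSubspace_of_dfn {X : Set M} {J : Set ι} (hJ : J.Finite)
    (hXJ : X ⊆ ⋃ j ∈ J, S.dom j) (hd : ∀ j, Dfn L (S.chart j '' (X ∩ S.dom j))) :
    S.IsDefinableSubspace X :=
  ⟨J, hJ, hXJ, fun j _ => hd j⟩

/-- An ld-map has a definable graph in all charts. -/
theorem IsLDMap.dfn_graph {θ : M → N} (hθ : IsLDMap S T θ) (i : ι) (k : κ) :
    DfnPred L fun w : Fin (S.dim i) ⊕ Fin (T.dim k) → R =>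
      ∃ x, x ∈ S.dom i ∧ θ x ∈ T.dom k ∧ (S.chart i x = fun a => w (.inl a)) ∧
        T.chart k (θ x) = fun b => w (.inr b) := by
  have h := (hθ i).2.dfn_chart_image (i, k)
  have h' := DfnPred.mem h (F := fun w : Fin (S.dim i) ⊕ Fin (T.dim k) → R =>
    (Fin.append (fun a => w (.inl a)) fun b => w (.inr b))) (fun b => by
      refine Fin.addCases (fun b => ?_) (fun b => ?_) b
      · simp only [Fin.append_left]
        exact .var _
      · simp only [Fin.append_right]
        exact .var _)
  convert! h' using 2
  constructor
  · rintro ⟨x, hx, hθx, h1, h2⟩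
    refine ⟨(x, θ x), ⟨⟨x, hx, rfl⟩, hx, hθx⟩, ?_⟩
    rw [← h1, ← h2]
    rfl
  · rintro ⟨_, ⟨⟨x, hx, rfl⟩, -, hθx⟩, h⟩
    refine ⟨x, hx, hθx, funext fun a => ?_, funext fun b => ?_⟩
    · have := congrFun h (Fin.castAdd _ a)
      simpa [prod] using this
    · have := congrFun h (Fin.natAdd _ b)
      simpa [prod] using this

/-- The image of a definable subspace under an ld-map is a definable subspace. -/
theorem IsDefinableSubspace.image {θ : M → N} (hθ : IsLDMap S T θ) {X : Set M}
    (hX : S.IsDefinableSubspace X) : T.IsDefinableSubspace (θ '' X) := by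
  have hd := hX.dfn_chart_image
  obtain ⟨J, hJ, hXJ, -⟩ := hX
  -- `K j` is a finite set of charts of `N` covering `θ '' S.dom j`.
  choose K hK hsub _ using fun j => (hθ j).1
  refine isDefinableSubspace_of_dfn (hJ.biUnion fun j _ => hK j) ?_ fun k => ?_
  · rintro _ ⟨x, hx, rfl⟩
    obtain ⟨j, hj, hxj⟩ := mem_iUnion₂.1 (hXJ hx)
    obtain ⟨k, hk, hxk⟩ := mem_iUnion₂.1 (hsub j (mem_image_of_mem θ hxj))
    exact mem_iUnion₂.2 ⟨k, mem_iUnion₂.2 ⟨j, hj, hk⟩, hxk⟩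
  have := hJ.to_subtype
  have e : T.chart k '' (θ '' X ∩ T.dom k) = {w | ∃ j : J, ∃ z, z ∈ S.chart j '' (X ∩ S.dom j) ∧
      ∃ x, x ∈ S.dom j ∧ θ x ∈ T.dom k ∧ S.chart j x = z ∧ T.chart k (θ x) = w} := by
    ext w
    constructor
    · rintro ⟨_, ⟨⟨x, hx, rfl⟩, hxk⟩, rfl⟩
      obtain ⟨j, hj, hxj⟩ := mem_iUnion₂.1 (hXJ hx)
      exact ⟨⟨j, hj⟩, S.chart j x, ⟨x, ⟨hx, hxj⟩, rfl⟩, x, hxj, hxk, rfl, rfl⟩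
    · rintro ⟨j, _, ⟨x, ⟨hx, hxj⟩, rfl⟩, x', hxj', hxk, h, rfl⟩
      obtain rfl := (S.bijOn j).injOn hxj' hxj h
      exact ⟨θ x', ⟨⟨x', hx, rfl⟩, hxk⟩, rfl⟩
  rw [e]
  exact DfnPred.exists_finite fun j => .exists_block (.and (.mem (hd j) fun b => .var _)
    ((hθ.dfn_graph j k).comp_family
      (P := fun z w => ∃ x, x ∈ S.dom j ∧ θ x ∈ T.dom k ∧ S.chart j x = z ∧ T.chart k (θ x) = w)
      (fun _ => .var _) fun _ => .var _))

theorem exists_isOpen_chart {W : Set M} (hW : IsOpen[S.topology] W) (i : ι) :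
    ∃ U, IsOpen U ∧ ∀ x ∈ S.dom i, x ∈ W ↔ S.chart i x ∈ U := by
  obtain ⟨U, hU, h⟩ := hW i
  refine ⟨U, hU, fun x hx => ⟨fun hxW => ?_, fun hxU => ?_⟩⟩
  · exact (h ▸ mem_image_of_mem _ ⟨hxW, hx⟩ : S.chart i x ∈ S.target i ∩ U).2
  · obtain ⟨x', ⟨hx'W, hx'⟩, hxx'⟩ : S.chart i x ∈ S.chart i '' (W ∩ S.dom i) :=
      h ▸ ⟨(S.bijOn i).mapsTo hx, hxU⟩
    exact (S.bijOn i).injOn hx' hx hxx' ▸ hx'W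

theorem isOpen_chart_preimage (k : ι) {U : Set (Fin (S.dim k) → R)} (hU : IsOpen U) :
    IsOpen[S.topology] {x | x ∈ S.dom k ∧ S.chart k x ∈ U} := by
  intro i
  obtain ⟨V, hV, hVeq⟩ := S.relOpen_overlap i k
  obtain ⟨g, hg, hgk⟩ := S.continuous_transition i k
  obtain ⟨W, hW, hWeq⟩ := continuousOn_iff'.1 hg U hU
  -- `V` cuts out the overlap with chart `k`, and `W` pulls `U` back along the transition map.
  refine ⟨W ∩ V, hW.inter hV, ?_⟩
  ext z
  constructor
  · rintro ⟨x, ⟨⟨hxk, hxU⟩, hxi⟩, rfl⟩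
    have hz : S.chart i x ∈ S.chart i '' (S.dom i ∩ S.dom k) := ⟨x, ⟨hxi, hxk⟩, rfl⟩
    have h1 : S.chart i x ∈ W ∩ S.chart i '' (S.dom i ∩ S.dom k) :=
      hWeq ▸ ⟨by rwa [mem_preimage, hgk x ⟨hxi, hxk⟩], hz⟩
    exact ⟨(S.bijOn i).mapsTo hxi, h1.1, (hVeq ▸ hz).2⟩
  · rintro ⟨hz, hzW, hzV⟩
    have hz' : z ∈ S.chart i '' (S.dom i ∩ S.dom k) := hVeq ▸ ⟨hz, hzV⟩
    have h1 : z ∈ g ⁻¹' U ∩ S.chart i '' (S.dom i ∩ S.dom k) := hWeq ▸ ⟨hzW, hz'⟩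
    obtain ⟨x, ⟨hxi, hxk⟩, rfl⟩ := hz'
    exact ⟨x, ⟨⟨hxk, hgk x ⟨hxi, hxk⟩ ▸ h1.1⟩, hxi⟩, rfl⟩

end Subspaces

/-! ### Paths in a single chart. -/

section Paths

variable {L : FirstOrder.Language.{u, v}} {R : Type*} [Field R] [LinearOrder R]
  [IsStrictOrderedRing R] [TopologicalSpace R] [L.Structure R] [OMinimalExpansion L R]
  {M ι : Type*} {S : LocDefSpace L R M ι}

/-- A path that is given by a continuous definable function in a chart is an ld-path. -/
theorem isLDPath_of_chart {i : ι} {g : R → Fin (S.dim i) → R}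
    (hg : ∀ k, DfnFun L fun v : Fin 1 → R => g (v 0) k) (hc : ContinuousOn g (Icc 0 1))
    {γ : Icc (0 : R) 1 → M} (hγ : ∀ s, γ s ∈ S.dom i) (hγg : ∀ s, S.chart i (γ s) = g s) :
    IsLDPath S γ := by
  refine ⟨@Continuous.mk _ _ (_) (_) _ fun W hW _ => ?_, fun _ => ⟨⟨{i}, finite_singleton i, ?_, ?_⟩,
    ⟨{((), i)}, finite_singleton _, ?_, ?_⟩⟩⟩
  · obtain ⟨U, hU, h⟩ := exists_isOpen_chart hW i
    obtain ⟨V, hV, hVeq⟩ := continuousOn_iff'.1 hc U hU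
    have key : ∀ s : Icc (0 : R) 1, γ s ∈ W ↔ (s : R) ∈ V := fun s => by
      rw [h _ (hγ s), hγg]
      have := Set.ext_iff.1 hVeq s
      simpa [s.2.1, s.2.2] using this
    refine ⟨{v : Fin 1 → R | v 0 ∈ V}, hV.preimage (continuous_apply (0 : Fin 1)), ?_⟩
    refine Set.ext fun v : Fin 1 → R => ?_
    constructor
    · rintro ⟨s, ⟨hs, -⟩, rfl⟩
      exact ⟨s.2, (key s).1 hs⟩
    · rintro ⟨hv, hvV⟩
      refine ⟨⟨v 0, hv⟩, ⟨(key ⟨v 0, hv⟩).2 hvV, mem_univ _⟩, ?_⟩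
      exact funext fun k : Fin 1 => congrArg v (Subsingleton.elim 0 k)
  · rintro _ ⟨s, -, rfl⟩
    simpa using hγ s
  · simp only [mem_singleton_iff, forall_eq]
    have e : S.chart i '' (γ '' univ ∩ S.dom i) =
        {z | ∃ s, (0 ≤ s ∧ s ≤ 1) ∧ ∀ k, z k = g s k} := by
      ext z
      constructor
      · rintro ⟨_, ⟨⟨s, -, rfl⟩, -⟩, rfl⟩
        exact ⟨s, s.2, fun k => by rw [hγg]⟩
      · rintro ⟨s, hs, h⟩
        exact ⟨_, ⟨⟨⟨s, hs⟩, mem_univ _, rfl⟩, hγ _⟩, (hγg _).trans (funext h).symm⟩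
    change Dfn L (S.chart i '' (γ '' univ ∩ S.dom i))
    rw [e]
    exact DfnPred.exists_elem (.and (.and (.le (.const 0) (.var _)) (.le (.var _) (.const 1)))
      (.forall_finite fun k => .eq (.var _) (DfnFun.comp_line (f := fun s => g s k) (hg k) (.var _))))
  · rintro _ ⟨s, -, rfl⟩
    simpa using ⟨mem_univ _, hγ s⟩
  · simp only [mem_singleton_iff, forall_eq]
    let c : Icc (0 : R) 1 → Fin (1 + S.dim i) → R := fun s =>
      Fin.append (fun _ : Fin 1 => (s : R)) (S.chart i (γ s))
    have e : range c = {z | (0 ≤ z (Fin.castAdd _ 0) ∧ z (Fin.castAdd _ 0) ≤ 1) ∧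
        ∀ k, z (Fin.natAdd 1 k) = g (z (Fin.castAdd _ 0)) k} := by
      ext z
      constructor
      · rintro ⟨s, rfl⟩
        simp only [c, hγg, mem_ofPred_eq, Fin.append_left, Fin.append_right, implies_true, and_true]
        exact s.2
      · rintro ⟨hs, h⟩
        refine ⟨⟨_, hs⟩, ?_⟩
        simp only [c, hγg]
        refine funext fun k => Fin.addCases (fun k => ?_) (fun k => ?_) k
        · rw [Fin.append_left, Subsingleton.elim k 0]
        · rw [Fin.append_right, h]
    have hc : Dfn L (range c) := by
      rw [e]
      exact DfnPred.and (.and (.le (.const 0) (.var _)) (.le (.var _) (.const 1)))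
        (.forall_finite fun k => .eq (.var _) (DfnFun.comp_line (f := fun s => g s k) (hg k)
          (.var _)))
    convert! hc using 1
    ext z
    constructor
    · rintro ⟨_, ⟨⟨s, -, rfl⟩, -⟩, rfl⟩
      exact ⟨s, rfl⟩
    · rintro ⟨s, rfl⟩
      exact ⟨_, ⟨⟨s, mem_univ _, rfl⟩, mem_univ _, hγ s⟩, rfl⟩

end Paths

end LocDefSpace

/-! ### Open boxes in `R^n`. -/

section Boxes

variable {R : Type*} [Field R] [LinearOrder R]

theorem isOpen_box [TopologicalSpace R] [OrderTopology R] {κ : Type*} [Finite κ] (z : κ → R)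
    (r : R) : IsOpen {w : κ → R | ∀ k, z k - r < w k ∧ w k < z k + r} := by
  simp only [ofPred_forall]
  exact isOpen_iInter_of_finite fun k => isOpen_Ioo.preimage (continuous_apply k)

variable [IsStrictOrderedRing R]

/-- The value `1` covers the empty family, which occurs for charts of dimension `0`. -/
theorem exists_pos_forall_le {κ : Type*} [Finite κ] {r : κ → R} (hr : ∀ k, 0 < r k) :
    ∃ ε > 0, ∀ k, ε ≤ r k := by
  cases nonempty_fintype κ
  rcases isEmpty_or_nonempty κ with h | h
  · exact ⟨1, one_pos, fun k => h.elim k⟩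
  · obtain ⟨k, hk⟩ := Finite.exists_min r
    exact ⟨r k, hr k, hk⟩

theorem IsOpen.exists_box_subset [TopologicalSpace R] [OrderTopology R] {κ : Type*} [Finite κ]
    {U : Set (κ → R)} (hU : IsOpen U) {z : κ → R} (hz : z ∈ U) :
    ∃ r > 0, ∀ w : κ → R, (∀ k, z k - r < w k ∧ w k < z k + r) → w ∈ U := by
  obtain ⟨u, hu, hsub⟩ := isOpen_pi_iff'.1 hU z hz
  have h : ∀ k, ∃ r > 0, Ioo (z k - r) (z k + r) ⊆ u k := fun k => by
    obtain ⟨r, hr, h⟩ := (nhds_basis_Ioo_pos (z k)).mem_iff.1 ((hu k).1.mem_nhds (hu k).2)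
    exact ⟨r, hr, h⟩
  choose r hr hru using h
  obtain ⟨ε, hε, hεr⟩ := exists_pos_forall_le hr
  refine ⟨ε, hε, fun w hw => hsub fun k _ => hru k ⟨?_, ?_⟩⟩
  · linarith [(hw k).1, hεr k]
  · linarith [(hw k).2, hεr k]

end Boxes

namespace LocDefSpace

/-! ### Curve selection, and closedness of the image. -/

section CurveSelection

variable {L : FirstOrder.Language.{u, v}} {R : Type*} [Field R] [LinearOrder R]
  [IsStrictOrderedRing R] [TopologicalSpace R] [OrderTopology R] [L.Structure R]
  [OMinimalExpansion L R] {M ι N κ : Type*} {S : LocDefSpace L R M ι} {T : LocDefSpace L R N κ}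

/-- Curve selection with a lift: a point `y` in the closure of `θ(C)` is approached by the image of
a definable continuous curve in `C` that lies in one chart. -/
theorem exists_curve_of_mem_closure {θ : M → N} (hθ : IsLDMap S T θ) {C : Set M}
    (hC : S.IsDefinableSubspace C) {y : N} (hy : y ∈ @closure N T.topology (θ '' C)) {k : κ}
    (hk : y ∈ T.dom k) :
    ∃ (i : ι) (f : R → Fin (S.dim i) → R) (γ : R → M) (ε : R), 0 < ε ∧
      (∀ l, DfnFun L fun v : Fin 1 → R => f (v 0) l) ∧ (∀ t ∈ Ioo 0 ε, ContinuousAt f t) ∧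
      ∀ t, 0 < t → γ t ∈ C ∧ γ t ∈ S.dom i ∧ S.chart i (γ t) = f t ∧ θ (γ t) ∈ T.dom k ∧
        ∀ l, T.chart k y l - t < T.chart k (θ (γ t)) l ∧
          T.chart k (θ (γ t)) l < T.chart k y l + t := by
  have near : ∀ t > 0, ∃ x ∈ C, θ x ∈ T.dom k ∧ ∀ l, T.chart k y l - t < T.chart k (θ x) l ∧
      T.chart k (θ x) l < T.chart k y l + t := fun t ht => by
    obtain ⟨_, ⟨hxk, hxt⟩, x, hx, rfl⟩ := (@mem_closure_iff N T.topology _ _).1 hy _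
      (isOpen_chart_preimage k (isOpen_box (T.chart k y) t)) ⟨hk, fun l => by constructor <;> linarith⟩
    exact ⟨x, hx, hxk, hxt⟩
  have hd := hC.dfn_chart_image
  obtain ⟨J, hJ, hCJ, -⟩ := hC
  have := hJ.to_subtype
  obtain ⟨i, hi⟩ : ∃ i : J, ∀ t > 0, ∃ x ∈ C, x ∈ S.dom i ∧ θ x ∈ T.dom k ∧
      ∀ l, T.chart k y l - t < T.chart k (θ x) l ∧ T.chart k (θ x) l < T.chart k y l + t := by
    -- If each of the finitely many charts failed at some radius, all would fail at the smallest of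
    -- these radii, contradicting `near`.
    by_contra! h
    choose t ht h using h
    obtain ⟨ε, hε, hεt⟩ := exists_pos_forall_le ht
    obtain ⟨x, hx, hxk, hxε⟩ := near ε hε
    obtain ⟨i, hi, hxi⟩ := mem_iUnion₂.1 (hCJ hx)
    obtain ⟨l, hl⟩ := h ⟨i, hi⟩ x hx hxi hxk
    have := hεt ⟨i, hi⟩
    linarith [hl (by linarith [(hxε l).1]), (hxε l).2]
  -- The choice is made on chart coordinates `z` of points of `C` whose image has coordinates `w` in
  -- the box of radius `t`.
  obtain ⟨f, hf, hfP⟩ := exists_dfnFun_choice_block (L := L) (α := Fin 1) (n := S.dim i)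
    (P := fun t z => z ∈ S.chart i '' (C ∩ S.dom i) ∧ ∃ w : Fin (T.dim k) → R,
      (∃ x, x ∈ S.dom i ∧ θ x ∈ T.dom k ∧ S.chart i x = z ∧ T.chart k (θ x) = w) ∧
      ∀ l, T.chart k y l - t 0 < w l ∧ w l < T.chart k y l + t 0)
    (.and (.mem (hd i) fun b => .var _) (.exists_block (.and
      ((hθ.dfn_graph i k).comp_family
        (P := fun z w => ∃ x, x ∈ S.dom i ∧ θ x ∈ T.dom k ∧ S.chart i x = z ∧ T.chart k (θ x) = w)
        (fun _ => .var _) fun _ => .var _)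
      (.forall_finite fun l => .and (.lt (.sub (.const _) (.var _)) (.var _))
        (.lt (.var _) (.add (.const _) (.var _)))))))
  have hγ : ∀ t, ∃ x, 0 < t → x ∈ C ∧ x ∈ S.dom i ∧ S.chart i x = f (fun _ => t) ∧
      θ x ∈ T.dom k ∧ ∀ l, T.chart k y l - t < T.chart k (θ x) l ∧
        T.chart k (θ x) l < T.chart k y l + t := fun t => by
    -- `x₀` is only a default value of `γ` for `t ≤ 0`.
    obtain ⟨x₀, -⟩ := near 1 one_pos
    by_cases ht : 0 < t
    · obtain ⟨⟨x, ⟨hxC, hxi⟩, hxf⟩, w, ⟨x', hx'i, hx'k, hx'f, rfl⟩, hw⟩ := hfP (fun _ => t) <| by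
        obtain ⟨x, hx, hxi, hxk, hxt⟩ := hi t ht
        exact ⟨S.chart i x, ⟨x, ⟨hx, hxi⟩, rfl⟩, _, ⟨x, hxi, hxk, rfl, rfl⟩, hxt⟩
      obtain rfl := (S.bijOn i).injOn hxi hx'i (hxf.trans hx'f.symm)
      exact ⟨x, fun _ => ⟨hxC, hxi, hxf, hx'k, hw⟩⟩
    · exact ⟨x₀, fun h => (ht h).elim⟩
  choose γ hγ using hγ
  have hf' : ∀ l, DfnFun L fun v : Fin 1 → R => f (fun _ => v 0) l := fun l =>
    Set.DefinableFun.comp (g := fun v _ => v 0) (fun _ => DfnFun.var _) (hf l)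
  choose b hb hbc using fun l => exists_continuousAt_right (L := L)
    (f := fun t => f (fun _ => t) l) (hf' l) 0
  obtain ⟨ε, hε, hεb⟩ := exists_pos_forall_le hb
  exact ⟨i, fun t => f fun _ => t, γ, ε, hε, hf', fun t ht => continuousAt_pi.2 fun l =>
    hbc l t ⟨ht.1, ht.2.trans_le (hεb l)⟩, hγ⟩

/-- The points of a continuous definable curve in one chart that stays in `Y` lie in one path
component of `Y`. -/
theorem mem_pathComponentIn_of_curve {Y : Set M} {i : ι} {f : R → Fin (S.dim i) → R}
    (hf : ∀ l, DfnFun L fun v : Fin 1 → R => f (v 0) l) {ε : R}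
    (hc : ∀ t ∈ Ioo 0 ε, ContinuousAt f t) {γ : R → M}
    (hγ : ∀ t ∈ Ioo 0 ε, γ t ∈ S.dom i ∧ S.chart i (γ t) = f t ∧ γ t ∈ Y) {a b : R}
    (ha : a ∈ Ioo 0 ε) (hb : b ∈ Ioo 0 ε) : γ b ∈ pathComponentIn S Y (γ a) := by
  -- The path is `γ` reparametrised affinely from `a` to `b`, in either order; convexity keeps the
  -- parameter in `(0, ε)`.
  have hmem : ∀ s ∈ Icc (0 : R) 1, a + s * (b - a) ∈ Ioo 0 ε := fun s hs => by
    have := (convex_Ioo 0 ε) ha hb (sub_nonneg.2 hs.2) hs.1 (by ring)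
    convert! this using 1
    simp only [smul_eq_mul]
    ring
  refine ⟨fun s => γ (a + s * (b - a)), isLDPath_of_chart (i := i)
    (g := fun s => f (a + s * (b - a))) (fun l => ?_) (fun s hs => ?_)
    (fun s => (hγ _ (hmem s s.2)).1) (fun s => (hγ _ (hmem s s.2)).2.1),
    fun s => (hγ _ (hmem s s.2)).2.2, by simp, by simp⟩
  · exact DfnFun.comp_line (f := fun s => f s l) (hf l)
      (.add (.const a) (.mul (.var _) (.const (b - a))))
  · refine (ContinuousAt.comp (g := f) (f := fun s => a + s * (b - a)) (hc _ (hmem s hs)) ?_).continuousWithinAt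
    exact (continuous_const.add (continuous_id.mul continuous_const)).continuousAt

/-- The image of a closed definable subspace under an ld-covering map is closed. -/
theorem IsLDCoveringMap.isClosed_image {θ : M → N} (hθ : IsLDCoveringMap S T θ) {C : Set M}
    (hC : S.IsDefinableSubspace C) (hCc : IsClosed[S.topology] C) :
    IsClosed[T.topology] (θ '' C) := by
  let _ := S.topology
  let _ := T.topology
  refine isClosed_of_closure_subset fun y hy => ?_
  obtain ⟨𝒪, hopen, hcover, -, hhomeo⟩ := hθ.exists_admissible
  obtain ⟨O, hO, hyO⟩ : y ∈ ⋃₀ 𝒪 := hcover ▸ mem_univ y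
  obtain ⟨k, hk⟩ : ∃ k, y ∈ T.dom k := mem_iUnion.1 (T.iUnion_dom ▸ mem_univ y)
  obtain ⟨i, f, γ, ε, hε, hf, hc, hγ⟩ := exists_curve_of_mem_closure hθ.isLDMap hC hy hk
  -- This is the convergence `θ (γ t) → y` as `t → 0`.
  have small : ∀ W : Set N, IsOpen W → y ∈ W → ∃ r > 0, ∀ t ∈ Ioo 0 r, θ (γ t) ∈ W := by
    intro W hW hyW
    obtain ⟨U, hU, hUW⟩ := exists_isOpen_chart hW k
    obtain ⟨r, hr, hbox⟩ := hU.exists_box_subset ((hUW y hk).1 hyW)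
    refine ⟨r, hr, fun t ht => ?_⟩
    obtain ⟨-, -, -, hθk, hl⟩ := hγ t ht.1
    exact (hUW _ hθk).2 (hbox _ fun l =>
      ⟨by linarith [(hl l).1, ht.2], by linarith [(hl l).2, ht.2]⟩)
  obtain ⟨r, hr, hrO⟩ := small O (hopen O hO).1 hyO
  obtain ⟨a, ha, ha'⟩ := exists_between (lt_min hε hr)
  have hmin : ∀ t ∈ Ioo 0 (min ε r), t ∈ Ioo 0 ε ∧ t ∈ Ioo 0 r := fun t ht =>
    ⟨⟨ht.1, ht.2.trans_le (min_le_left _ _)⟩, ht.1, ht.2.trans_le (min_le_right _ _)⟩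
  -- The curve stays in the component of its point at parameter `a`, so one sheet over `O` suffices.
  have hD : ∀ t ∈ Ioo 0 (min ε r), γ t ∈ pathComponentIn S (θ ⁻¹' O) (γ a) := fun t ht =>
    mem_pathComponentIn_of_curve hf (fun t ht => hc t (hmin t ht).1)
      (fun t ht => ⟨(hγ t ht.1).2.1, (hγ t ht.1).2.2.1, hrO t (hmin t ht).2⟩) ⟨ha, ha'⟩ ht
  obtain ⟨-, -, -, e, he⟩ := hhomeo O hO (γ a) (hrO a (hmin a ⟨ha, ha'⟩).2)
  obtain ⟨x, hx⟩ := e.surjective ⟨y, hyO⟩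
  refine ⟨x, ?_, by rw [← he, hx]⟩
  rw [← hCc.closure_eq, mem_closure_iff]
  intro W hW hxW
  -- Continuity of the inverse of the sheet turns a neighbourhood `W` of `x` into a neighbourhood
  -- `W'` of `y`, which contains `θ (γ t)` for small `t`.
  obtain ⟨W', hW', hWW'⟩ := (e.symm.continuous.isOpen_preimage _
    (hW.preimage continuous_subtype_val))
  have key : ∀ z : pathComponentIn S (θ ⁻¹' O) (γ a), (z : M) ∈ W ↔ (e z : N) ∈ W' := fun z => by
    have := Set.ext_iff.1 hWW' (e z)
    simpa using this.symm
  obtain ⟨r', hr', hr'W⟩ := small W' hW' (by simpa [hx] using (key x).1 hxW)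
  obtain ⟨t, ht, ht'⟩ := exists_between (lt_min (lt_min hε hr) hr')
  have htr := hr'W t ⟨ht, ht'.trans_le (min_le_right _ _)⟩
  have htD := hD t ⟨ht, ht'.trans_le (min_le_left _ _)⟩
  exact ⟨γ t, (key ⟨γ t, htD⟩).2 (by rwa [he]), (hγ t ht).1⟩

end CurveSelection

end LocDefSpace

theorem proposition2p7 {L : FirstOrder.Language.{u, v}} {R : Type*} [Field R] [LinearOrder R]
    [IsStrictOrderedRing R] [IsRealClosed R] [TopologicalSpace R] [OrderTopology R]
    [L.Structure R] [OMinimalExpansion L R] {M ι N κ : Type*}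
    (S : LocDefSpace L R M ι) (T : LocDefSpace L R N κ) (hS : S.IsLDSpace) (hT : T.IsLDSpace)
    (θ : M → N) (hθ : LocDefSpace.IsLDCoveringMap S T θ)
    (C : Set M) (hC : S.IsDefinableSubspace C) (hCc : IsClosed[S.topology] C) :
    T.IsDefinableSubspace (θ '' C) ∧ IsClosed[T.topology] (θ '' C) := by
  exact ⟨hC.image hθ.isLDMap, hθ.isClosed_image hC hCc⟩
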